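/- **Setting.** Let $X$ be a finite set of field labels, $V$ the complex vector space with basis $\{\phi(x)\}_{x\in X}$, and $\mathsf S(V)$ its symmetric algebra, with the coproduct $\Delta:\mathsf S(V)\to\mathsf S(V)\otimes\mathsf S(V)$, the algebra map determined by $\Delta(\phi(x))=\phi(x)\otimes\mathbf 1+\mathbf 1\otimes\phi(x)$. Let $G_F$ (the Feynman propagator) be an invertible symmetric complex $X\times X$ matrix with inverse $G_F^{-1}$. Let $A=\mathbb C[[g_j: j\in J]]$ be a ring of formal power series (in coupling constants $g_j$) and let $\nu:\mathsf S(V)\to A$ be a linear map (the interaction) whose values have zero constant term and such that for each monomial $g^d$ its coefficient in $\nu(\phi(y_1)\cdots\phi(y_m))$ vanishes for all $y_1,\dots,y_m$ once $m$ is large enough. A Feynman graph with $n$ external legs consists of finitely many, and at least one, vertices, of internal edges joining vertices (multiple edges and self-loops allowed), and of external legs $1,\dots,n$, each attached to a vertex. Its value at $x_1,\dots,x_n\in X$ is the sum, over all labels in $X$ of the edge ends at the vertices, of the product of: a factor $G_F(a,b)$ for each internal edge with end labels $a,b$; a factor $G_F(x_l,c_l)$ for the $l$-th external leg with inner label $c_l$;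 a factor $\nu(\phi(y_1)\cdots\phi(y_m))$ for each vertex whose edge ends are labeled $y_1,\dots,y_m$. For $n\ge1$ let $G_c^{(n)}(x_1,\dots,x_n)\in A$ be the sum over all isomorphism classes of connected Feynman graphs with $n$ external legs of their values, each multiplied by the symmetry factor $1/|\mathrm{Aut}|$ (automorphisms fix the external legs), and let $G_{\rm 1PI}^{(n)}(x_1,\dots,x_n)$ be the same sum over the 1PI graphs, i.e. those that are connected and remain connected when any one internal edge is cut. (So for $n=2$ the edge without vertices, with value $G_F(x_1,x_2)$, is not counted: $G_c^{(2)}$ is the full connected propagator minus $G_F$.) Assume that all 1PI $1$-point functions vanish. Let $R=\sum_{x,y}G_F^{-1}(x,y)\,\phi(x)\otimes\phi(y)$, acting on $\mathsf S(V)\otimes\mathsf S(V)$ by multiplication, let $Q=\frac12R\circ\Delta$, let $Q_i=\mathrm{id}^{\otimes i-1}\otimes Q\otimes\mathrm{id}^{\otimes k-i}:\mathsf S(V)^{\otimes k}\to\mathsf S(V)^{\otimes k+1}$, and define $\Lambda^k:\mathsf S(V)\to\mathsf S(V)^{\otimes k+1}$ by $\Lambda^0=\mathrm{id}$, $\Lambda^k=\frac1k\sum_{i=1}^kQ_i\circ\Lambda^{k-1}$.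 **Theorem.** (1) For each monomial in the couplings only finitely many Feynman graphs with given labeled legs have a value in which it occurs; there are (unique) linear maps $\sigma,\tau:\mathsf S(V)\to A$ with $\sigma(\mathbf 1)=\tau(\mathbf 1)=0$ and $\sigma(\phi(x_1)\cdots\phi(x_n))=G_c^{(n)}(x_1,\dots,x_n)$, $\tau(\phi(x_1)\cdots\phi(x_n))=G_{\rm 1PI}^{(n)}(x_1,\dots,x_n)$ for $n\ge1$; and $$\sigma=\sum_{k=1}^\infty\tau^{\otimes k}\circ\Lambda^{k-1},$$ where on each element of $\mathsf S(V)$ only finitely many summands contribute to the coefficient of a given monomial in the couplings. (2) For a graph $t$ on the vertices $1,\dots,k$ ($k\ge1$) and a map $e:\{1,\dots,n\}\to\{1,\dots,k\}$ that attaches external legs labeled $x_1,\dots,x_n$ to the vertices, let $[t,e]\in\mathsf S(V)^{\otimes k}$ be the product of the elements $R_{i,j}=\sum_{x,y}G_F^{-1}(x,y)\,\phi(x)_i\,\phi(y)_j$ over the edges $\{i<j\}$ of $t$ and of the elements $\phi(x_l)_{e(l)}$, $l=1,\dots,n$, where $a_i$ denotes $a$ in the $i$-th tensor factor and $\mathbf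 1$ in the others. For all $k\ge1$ and $n\ge0$ there are rational weights $w(t,e)$, depending only on $t$ and $e$ and zero unless $t$ is a tree, such that $\Lambda^{k-1}(\phi(x_1)\cdots\phi(x_n))=\sum_{t,e}w(t,e)\,[t,e]$ for all $X$, $G_F$ as above and all $x_1,\dots,x_n\in X$; and each tree with $k$ unordered vertices and legs $1,\dots,n$, all of whose vertices have valence at least two (external legs included), has weight $1$: the sum of $w(t,e)$ over all distinct orderings $(t,e)$ of its vertices is $1$. -/

import Mathlib

open scoped TensorProduct

noncomputable section

namespace NPoint

universe u v

/-! ### The field operator algebra -/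

/-- The symmetric algebra `S(V)` over the space `V` of complex linear combinations of elementary
field operators `φ(x)`, one for each label `x : X`. -/
abbrev FieldAlg (X : Type u) : Type u := SymmetricAlgebra ℂ (X →₀ ℂ)

/-- The elementary field operator `φ(x)`. -/
def phi {X : Type u} (x : X) : FieldAlg X :=
  SymmetricAlgebra.ι ℂ (X →₀ ℂ) (Finsupp.single x 1)

/-- The coproduct of `S(V)`: the algebra map with `Δ(v) = v ⊗ 1 + 1 ⊗ v` for `v ∈ V`. -/
def coproduct (X : Type u) : FieldAlg X →ₐ[ℂ] FieldAlg X ⊗[ℂ] FieldAlg X :=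
  SymmetricAlgebra.lift
    ((Algebra.TensorProduct.includeLeft (R := ℂ) (S := ℂ) (A := FieldAlg X)
        (B := FieldAlg X)).toLinearMap ∘ₗ SymmetricAlgebra.ι ℂ (X →₀ ℂ) +
      (Algebra.TensorProduct.includeRight (R := ℂ) (A := FieldAlg X)
        (B := FieldAlg X)).toLinearMap ∘ₗ SymmetricAlgebra.ι ℂ (X →₀ ℂ))

/-- The `k`-fold tensor product `S(V)^{⊗ k}`, a commutative algebra. -/
abbrev TPow (X : Type u) (k : ℕ) : Type u := ⨂[ℂ] (_ : Fin k), FieldAlg X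

/-- `a ↦ 1 ⊗ ⋯ ⊗ a ⊗ ⋯ ⊗ 1`, with `a` in position `i`. -/
def single {X : Type u} {k : ℕ} (i : Fin k) : FieldAlg X →ₐ[ℂ] TPow X k :=
  PiTensorProduct.singleAlgHom (R := ℂ) (A := fun _ : Fin k => FieldAlg X) i

/-- The linear functional `τ ⊗ ⋯ ⊗ τ` on `S(V)^{⊗ k}`,
`a₁ ⊗ ⋯ ⊗ a_k ↦ τ(a₁) ⋯ τ(a_k)`. -/
def tensorFunctional {X : Type u} {A : Type v} [CommRing A] [Algebra ℂ A]
    (τ : FieldAlg X →ₗ[ℂ] A) (k : ℕ) : TPow X k →ₗ[ℂ] A :=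
  PiTensorProduct.lift
    ((MultilinearMap.mkPiAlgebra ℂ (Fin k) A).compLinearMap fun _ => τ)

/-! ### The maps `Q`, `Q_i` and `Λ^k`; throughout `G` is the Feynman propagator -/

section Lambda

variable {X : Type u} [Fintype X] [DecidableEq X]

/-- `R = ∑_{x,y} G⁻¹(x,y) φ(x) ⊗ φ(y)`. -/
def R (G : Matrix X X ℂ) : FieldAlg X ⊗[ℂ] FieldAlg X :=
  ∑ x, ∑ y, G⁻¹ x y • (phi x ⊗ₜ[ℂ] phi y)

/-- `Q = ½ R ∘ Δ`, where `R` acts by multiplication. -/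
def Q (G : Matrix X X ℂ) : FieldAlg X →ₗ[ℂ] FieldAlg X ⊗[ℂ] FieldAlg X :=
  (1 / 2 : ℂ) • (LinearMap.mulLeft ℂ (R G) ∘ₗ (coproduct X).toLinearMap)

/-- `Q_i = id ⊗ ⋯ ⊗ Q ⊗ ⋯ ⊗ id`, with `Q` applied to the `i`-th tensor factor: the factors before
the `i`-th keep their position, `Q(a_i)` occupies the positions `i` and `i + 1`, and the later
factors move one position to the right. -/
def Qi (G : Matrix X X ℂ) {k : ℕ} (i : Fin k) : TPow X k →ₗ[ℂ] TPow X (k + 1) :=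
  PiTensorProduct.lift
    ((MultilinearMap.mkPiAlgebra ℂ (Fin k) (TPow X (k + 1))).compLinearMap fun j =>
      if j < i then (single j.castSucc).toLinearMap
      else if j = i then
        (Algebra.TensorProduct.productMap (single i.castSucc) (single i.succ)).toLinearMap ∘ₗ Q G
      else (single j.succ).toLinearMap)

/-- `Λ^k : S(V) → S(V)^{⊗ (k+1)}`, with `Λ^0 = id` and `Λ^k = (1/k) ∑_{i=1}^k Q_i ∘ Λ^{k-1}`. -/
def Lambda (G : Matrix X X ℂ) : (k : ℕ) → FieldAlg X →ₗ[ℂ] TPow X (k + 1)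
  | 0 => (single (0 : Fin 1)).toLinearMap
  | k + 1 => (1 / ((k + 1 : ℕ) : ℂ)) • ∑ i : Fin (k + 1), Qi G i ∘ₗ Lambda G k

/-- `σ^{k+1} = τ^{⊗ (k+1)} ∘ Λ^k`. -/
def sigmaComponent {A : Type v} [CommRing A] [Algebra ℂ A] (G : Matrix X X ℂ)
    (τ : FieldAlg X →ₗ[ℂ] A) (k : ℕ) : FieldAlg X →ₗ[ℂ] A :=
  tensorFunctional τ (k + 1) ∘ₗ Lambda G k

/-! ### Tree graphs with ordered vertices as elements of `S(V)^{⊗ k}` -/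

/-- `R_{i,j}`: the operators `φ(x)` and `φ(y)` are inserted in positions `i` and `j`. -/
def Rij (G : Matrix X X ℂ) {k : ℕ} (i j : Fin k) : TPow X k :=
  ∑ x, ∑ y, G⁻¹ x y • (single i (phi x) * single j (phi y))

open Classical in
/-- The element of `S(V)^{⊗ k}` of the graph with vertices `1, …, k`, internal edges those of `t`,
and external legs labeled `x₁, …, xₙ`, the `l`-th leg being attached to the vertex `e l`. -/
def graphElement (G : Matrix X X ℂ) {k n : ℕ} (t : SimpleGraph (Fin k)) (e : Fin n → Fin k)
    (x : Fin n → X) : TPow X k :=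
  (∏ ij : Fin k × Fin k with ij.1 < ij.2 ∧ t.Adj ij.1 ij.2, Rij G ij.1 ij.2) *
    ∏ l, single (e l) (phi (x l))

end Lambda

open Classical in
/-- The valence of the vertex `i`: internal edges and external legs at `i`. -/
def valence {k n : ℕ} (t : SimpleGraph (Fin k)) (e : Fin n → Fin k) (i : Fin k) : ℕ :=
  t.degree i + (Finset.univ.filter fun l => e l = i).card

/-- `(t', e')` arises from `(t, e)` by changing the order of the vertices, i.e. both are the same
graph with unordered vertices and labeled external legs. -/
def SameUnordered {k n : ℕ} (t t' : SimpleGraph (Fin k)) (e e' : Fin n → Fin k) : Prop :=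
  ∃ π : Equiv.Perm (Fin k), (∀ i j, t'.Adj (π i) (π j) ↔ t.Adj i j) ∧ ∀ l, e' l = π (e l)

/-! ### Feynman graphs and their values -/

/-- A Feynman graph with `n` external legs, its `p` vertices and `q` internal edges being numbered
and its internal edges oriented. Multiple edges and self-loops are allowed. -/
structure FeynmanGraph (n : ℕ) where
  p : ℕ
  q : ℕ
  src : Fin q → Fin p
  tgt : Fin q → Fin p
  leg : Fin n → Fin p

namespace FeynmanGraph

variable {n : ℕ}

/-- Connectedness (with at least one vertex) when only the internal edges in `E` are kept. -/
def ConnectedBy (Γ : FeynmanGraph n) (E : Set (Fin Γ.q)) : Prop :=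
  (SimpleGraph.fromRel fun a b => ∃ j ∈ E, Γ.src j = a ∧ Γ.tgt j = b).Connected

def IsConnected (Γ : FeynmanGraph n) : Prop := Γ.ConnectedBy Set.univ

/-- One-particle irreducible: connected, and still connected when any one internal edge is cut. -/
def Is1PI (Γ : FeynmanGraph n) : Prop :=
  Γ.IsConnected ∧ ∀ j, Γ.ConnectedBy {j}ᶜ

/-- The weight of a numbered and oriented graph. A graph without numbering and orientation has
`p! q! 2^q / |Aut|` numberings and orientations (automorphisms fix the external legs), so the
weights of these add up to the usual symmetry factor `1 / |Aut|`. -/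
def weight (Γ : FeynmanGraph n) : ℂ :=
  1 / ((Γ.p.factorial : ℂ) * (Γ.q.factorial : ℂ) * 2 ^ Γ.q)

variable {X : Type u} [Fintype X] {A : Type v} [CommRing A] [Algebra ℂ A]

/-- The value of a Feynman graph by the Feynman rules: a propagator `G` for each internal edge and
each external leg, the vertex function `ν(φ(y₁)⋯φ(yₘ))` for each vertex with `m` edge ends labeled
`y₁, …, yₘ`, summed over the labels `a j`, `b j` at the two ends of each internal edge `j` and the
label `c l` at the inner end of each external leg `l`. -/
def value (G : Matrix X X ℂ) (ν : FieldAlg X →ₗ[ℂ] A) (Γ : FeynmanGraph n) (x : Fin n → X) : A :=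
  ∑ a : Fin Γ.q → X, ∑ b : Fin Γ.q → X, ∑ c : Fin n → X,
    ((∏ j, G (a j) (b j)) * ∏ l, G (x l) (c l)) •
      ∏ i : Fin Γ.p, ν ((∏ j with Γ.src j = i, phi (a j)) * (∏ j with Γ.tgt j = i, phi (b j)) *
        ∏ l with Γ.leg l = i, phi (c l))

end FeynmanGraph

/-! ### Perturbative `n`-point functions: formal power series in coupling constants -/

section Perturbative

variable {X : Type u} [Fintype X] {J : Type v}

/-- A perturbative interaction: every vertex carries a positive order in the couplings, and at each
order only finitely many valences occur. -/
structure IsInteraction (ν : FieldAlg X →ₗ[ℂ] MvPowerSeries J ℂ) : Prop where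
  constantCoeff_eq_zero : ∀ a, MvPowerSeries.constantCoeff (ν a) = 0
  finite_order : ∀ d : J →₀ ℕ, ∃ D : ℕ, ∀ m > D, ∀ y : Fin m → X,
    MvPowerSeries.coeff d (ν (∏ i, phi (y i))) = 0

open Classical in
/-- The sum of the values, with symmetry factors, of all Feynman graphs with property `P` and `n`
external legs labeled `x₁, …, xₙ`, taken order by order in the couplings. -/
def graphSum (G : Matrix X X ℂ) (ν : FieldAlg X →ₗ[ℂ] MvPowerSeries J ℂ) {n : ℕ}
    (P : FeynmanGraph n → Prop) (x : Fin n → X) : MvPowerSeries J ℂ :=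
  fun d => ∑ᶠ Γ : FeynmanGraph n,
    if P Γ then Γ.weight * MvPowerSeries.coeff d (Γ.value G ν x) else 0

/-- The connected `n`-point function `G_c(x₁, …, xₙ)`. All graphs here have at least one vertex, so
for `n = 2` the edge without vertices, with value `G(x₁, x₂)`, is not counted. -/
def connectedFn (G : Matrix X X ℂ) (ν : FieldAlg X →ₗ[ℂ] MvPowerSeries J ℂ) (n : ℕ)
    (x : Fin n → X) : MvPowerSeries J ℂ :=
  graphSum G ν FeynmanGraph.IsConnected x

/-- The 1PI `n`-point function `G_1PI(x₁, …, xₙ)`. -/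
def onePIFn (G : Matrix X X ℂ) (ν : FieldAlg X →ₗ[ℂ] MvPowerSeries J ℂ) (n : ℕ)
    (x : Fin n → X) : MvPowerSeries J ℂ :=
  graphSum G ν FeynmanGraph.Is1PI x

/-- `ρ` is the linear map on `S(V)` of the ensemble `F` of `n`-point functions, with vanishing
`0`-point function. -/
def IsNPointMap (F : (n : ℕ) → (Fin n → X) → MvPowerSeries J ℂ)
    (ρ : FieldAlg X →ₗ[ℂ] MvPowerSeries J ℂ) : Prop :=
  ρ 1 = 0 ∧ ∀ n, 1 ≤ n → ∀ x : Fin n → X, ρ (∏ i, phi (x i)) = F n x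

end Perturbative

end NPoint

end

open scoped TensorProduct

noncomputable section

namespace NPoint

universe u v

/-! The theorem has two independent halves.

Connected and 1PI functions. Connected graphs are graded by their number `b` of bridges; let `C_b`
be the sum over those with `b` bridges, so that `C_0` is the 1PI function. Marking one of the `b +
1` bridges of a graph and cutting it leaves an ordered pair of connected graphs, ordered by the
orientation of the bridge, whose bridge numbers add up to `b`. Both halves receive a leg with its
own propagator, and `G⁻¹` removes the surplus one. With symmetry factors this gives `(b + 1) C_{b+1}
= ½ ∑ G⁻¹ C_a C_c` over `a + c = b` and over distributions of the legs (`bridgeFn_succ`).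
Equivalently, the formal series `S = ∑ C_b T^b` solves `dS/dT = (S ⊗ S) ∘ Q`
(`derivative_bridgeSeries`). By the Leibniz rule a solution with `S(0) = τ` has `m`-th Taylor
coefficient `τ^{⊗(m+1)} ∘ Λ^m`, the factors `1/k` in `Λ^k` producing the `1/m!`
(`sigmaComponent_eq_coeff`). Hence each summand of the asserted formula is a `C_b`, and their sum is
the connected function.

Without legs, `σ(1) = τ(1) = 0` is imposed. The coefficient `C_0` at zero legs may be dropped
because the flow never uses it: both halves of a cut have a leg. The other `C_b` at zero legs vanish
with the 1PI one-point function, since cutting a bridge of a graph with at most one leg leaves a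
half with a single leg, and induction on `b` applies (`bridgeFn_eq_zero_of_card_le_one`).

Weights of trees. Since `Q_i` is `½ R_{i,i+1}` times the algebra map splitting the `i`-th factor
(`Qi_eq`), it sends a graph to the sum of all graphs that contract to it along a new edge from `i`
to `i + 1`. So the coefficients in `Λ^k` of graphs with numbered oriented edges obey a recursion by
contraction of the newest edge (`treeWeight`). For a fixed connected graph with `k` numbered
oriented edges, the orderings of its vertices that put the ends of the newest edge at adjacent
positions in the right order are the orderings of the contracted graph, so the weights over all
orderings add up to `1/(k! 2^k)` (`sum_treeWeight_perm`). A tree has `k! 2^k` numberings and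
orientations of its edges (`card_edgesGraph_eq`), whence total weight one over all permutations of
the vertices. If all valences are at least two, every leaf carries a leg, the tree has no
automorphism fixing the legs (`eq_one_of_fixes_legs`), and permutations correspond to distinct
orderings. -/

/-! ### Connectedness by cuts -/

/-- The edges in `E`, with ends given by `s` and `t`, connect the nonempty set `P`: no proper subset
of `P` is a union of components. -/
def Joined {P Q : Type*} (s t : Q → P) (E : Set Q) : Prop :=
  Nonempty P ∧ ∀ f : P → Prop, (∀ j ∈ E, f (s j) ↔ f (t j)) → ∀ a b, f a → f b

/-- A predicate constant along edges is constant along walks; conversely reachability from a fixed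
vertex is such a predicate. Self-loops, which a simple graph discards, impose no condition. -/
theorem connected_fromRel_iff {P Q : Type*} (s t : Q → P) (E : Set Q) :
    (SimpleGraph.fromRel fun a b => ∃ j ∈ E, s j = a ∧ t j = b).Connected ↔ Joined s t E := by
  constructor
  · intro h
    refine ⟨h.nonempty, fun f hf a b ha => ?_⟩
    obtain ⟨w⟩ := h.preconnected a b
    induction w with
    | nil => exact ha
    | cons hadj _ ih =>
      apply ih
      rw [SimpleGraph.fromRel_adj] at hadj
      obtain ⟨-, ⟨j, hj, rfl, rfl⟩ | ⟨j, hj, rfl, rfl⟩⟩ := hadj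
      · exact (hf j hj).1 ha
      · exact (hf j hj).2 ha
  · rintro ⟨hne, h⟩
    refine SimpleGraph.connected_iff_exists_forall_reachable _ |>.2 ?_
    obtain ⟨a⟩ := hne
    refine ⟨a, fun b => h (fun c => SimpleGraph.Reachable _ a c) ?_ a b (SimpleGraph.Reachable.refl a)⟩
    intro j hj
    by_cases hst : s j = t j
    · rw [hst]
    · have hadj : (SimpleGraph.fromRel fun a b => ∃ j ∈ E, s j = a ∧ t j = b).Adj (s j) (t j) :=
        (SimpleGraph.fromRel_adj _ _ _).2 ⟨hst, Or.inl ⟨j, hj, rfl, rfl⟩⟩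
      exact ⟨fun h => h.trans hadj.reachable, fun h => h.trans hadj.symm.reachable⟩

theorem joined_congr {P Q P' Q' : Type*} (eP : P ≃ P') (eQ : Q ≃ Q') (s t : Q → P) (E : Set Q) :
    Joined (eP ∘ s ∘ eQ.symm) (eP ∘ t ∘ eQ.symm) (eQ '' E) ↔ Joined s t E := by
  constructor
  · rintro ⟨⟨a⟩, h⟩
    refine ⟨⟨eP.symm a⟩, fun f hf a b ha => ?_⟩
    have := h (fun c => f (eP.symm c)) ?_ (eP a) (eP b) (by simpa using ha)
    · simpa using this
    · rintro _ ⟨j, hj, rfl⟩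
      simpa using hf j hj
  · rintro ⟨⟨a⟩, h⟩
    refine ⟨⟨eP a⟩, fun f hf a b ha => ?_⟩
    have := h (fun c => f (eP c)) (fun j hj => ?_) (eP.symm a) (eP.symm b) (by simpa using ha)
    · simpa using this
    · simpa using hf (eQ j) ⟨j, hj, rfl⟩

/-! ### Graphs with arbitrary sets of vertices, edges and legs -/

/-- A graph with vertex set `P`, set of oriented edges `Q` and set of legs `L`. -/
@[ext]
structure LGraph (P Q L : Type*) where
  src : Q → P
  tgt : Q → P
  leg : L → P

namespace LGraph

variable {P Q L P' Q' L' P₁ P₂ Q₁ Q₂ L₁ L₂ : Type*}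

/-- A graph as a triple of maps. -/
def equivProd (P Q L : Type*) : LGraph P Q L ≃ (Q → P) × (Q → P) × (L → P) where
  toFun Γ := (Γ.src, Γ.tgt, Γ.leg)
  invFun f := ⟨f.1, f.2.1, f.2.2⟩
  left_inv _ := rfl
  right_inv _ := rfl

instance [Fintype P] [Fintype Q] [Fintype L] [DecidableEq Q] [DecidableEq L] :
    Fintype (LGraph P Q L) :=
  Fintype.ofEquiv _ (equivProd P Q L).symm

/-- Connectedness when only the edges in `E` are kept. -/
def JoinedBy (Γ : LGraph P Q L) (E : Set Q) : Prop := Joined Γ.src Γ.tgt E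

/-- The edge `j` is a bridge: the graph is disconnected when `j` is cut. -/
def IsBridge (Γ : LGraph P Q L) (j : Q) : Prop := ¬ Γ.JoinedBy {j}ᶜ

open Classical in
/-- The number of bridges. -/
def bridgeCount [Fintype Q] (Γ : LGraph P Q L) : ℕ := ∑ j, if Γ.IsBridge j then 1 else 0

theorem bridgeCount_le [Fintype Q] (Γ : LGraph P Q L) : Γ.bridgeCount ≤ Fintype.card Q := by
  unfold bridgeCount
  calc _ ≤ ∑ _j : Q, 1 := Finset.sum_le_sum fun j _ => by split_ifs <;> simp
    _ = _ := by simp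

theorem bridgeCount_eq_zero [Fintype Q] {Γ : LGraph P Q L} :
    Γ.bridgeCount = 0 ↔ ∀ j, Γ.JoinedBy {j}ᶜ := by
  rw [bridgeCount, Finset.sum_eq_zero_iff]
  refine forall_congr' fun j => ?_
  by_cases h : Γ.JoinedBy {j}ᶜ <;> simp [IsBridge, h]

/-- Transport of a graph along bijections. -/
def transport (eP : P ≃ P') (eQ : Q ≃ Q') (eL : L ≃ L') : LGraph P Q L ≃ LGraph P' Q' L' where
  toFun Γ := ⟨eP ∘ Γ.src ∘ eQ.symm, eP ∘ Γ.tgt ∘ eQ.symm, eP ∘ Γ.leg ∘ eL.symm⟩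
  invFun Γ := ⟨eP.symm ∘ Γ.src ∘ eQ, eP.symm ∘ Γ.tgt ∘ eQ, eP.symm ∘ Γ.leg ∘ eL⟩
  left_inv Γ := by ext <;> simp
  right_inv Γ := by ext <;> simp

theorem joinedBy_transport (eP : P ≃ P') (eQ : Q ≃ Q') (eL : L ≃ L') (Γ : LGraph P Q L) (E : Set Q) :
    (transport eP eQ eL Γ).JoinedBy (eQ '' E) ↔ Γ.JoinedBy E :=
  joined_congr eP eQ Γ.src Γ.tgt E

theorem joinedBy_univ_transport (eP : P ≃ P') (eQ : Q ≃ Q') (eL : L ≃ L') (Γ : LGraph P Q L) :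
    (transport eP eQ eL Γ).JoinedBy Set.univ ↔ Γ.JoinedBy Set.univ := by
  rw [← joinedBy_transport eP eQ eL Γ, Set.image_univ, eQ.range_eq_univ]

theorem isBridge_transport (eP : P ≃ P') (eQ : Q ≃ Q') (eL : L ≃ L') (Γ : LGraph P Q L) (j : Q) :
    (transport eP eQ eL Γ).IsBridge (eQ j) ↔ Γ.IsBridge j := by
  rw [IsBridge, IsBridge, ← joinedBy_transport eP eQ eL Γ, Set.image_compl_eq eQ.bijective,
    Set.image_singleton]

theorem bridgeCount_transport [Fintype Q] [Fintype Q'] (eP : P ≃ P') (eQ : Q ≃ Q') (eL : L ≃ L')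
    (Γ : LGraph P Q L) : (transport eP eQ eL Γ).bridgeCount = Γ.bridgeCount := by
  unfold bridgeCount
  classical
  rw [← eQ.sum_comp]
  exact Finset.sum_congr rfl fun j _ => if_congr (isBridge_transport eP eQ eL Γ j) rfl rfl

/-! ### Gluing two graphs along a new edge -/

/-- Two graphs joined by a new edge `none`, made from the legs `none` of both. -/
def glue (Γ₁ : LGraph P₁ Q₁ (Option L₁)) (Γ₂ : LGraph P₂ Q₂ (Option L₂)) :
    LGraph (P₁ ⊕ P₂) (Option (Q₁ ⊕ Q₂)) (L₁ ⊕ L₂) where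
  src j := j.elim (.inl (Γ₁.leg none)) (Sum.map Γ₁.src Γ₂.src)
  tgt j := j.elim (.inr (Γ₂.leg none)) (Sum.map Γ₁.tgt Γ₂.tgt)
  leg := Sum.map (fun l => Γ₁.leg (some l)) (fun l => Γ₂.leg (some l))

/-- A test predicate on one half extends to the other half as the constant given by its value at the
new edge. -/
theorem joinedBy_glue (Γ₁ : LGraph P₁ Q₁ (Option L₁)) (Γ₂ : LGraph P₂ Q₂ (Option L₂))
    {E : Set (Option (Q₁ ⊕ Q₂))} (hE : none ∈ E) :
    (glue Γ₁ Γ₂).JoinedBy E ↔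
      Γ₁.JoinedBy {j | some (.inl j) ∈ E} ∧ Γ₂.JoinedBy {j | some (.inr j) ∈ E} := by
  constructor
  · rintro ⟨-, h⟩
    refine ⟨⟨⟨Γ₁.leg none⟩, fun f hf a b ha => ?_⟩, ⟨⟨Γ₂.leg none⟩, fun f hf a b ha => ?_⟩⟩
    · refine h (Sum.elim f fun _ => f (Γ₁.leg none)) ?_ (.inl a) (.inl b) ha
      rintro (_ | j | j) hj
      · simp [glue]
      · exact hf j hj
      · simp [glue]
    · refine h (Sum.elim (fun _ => f (Γ₂.leg none)) f) ?_ (.inr a) (.inr b) ha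
      rintro (_ | j | j) hj
      · simp [glue]
      · simp [glue]
      · exact hf j hj
  · rintro ⟨⟨-, h₁⟩, ⟨-, h₂⟩⟩
    refine ⟨⟨.inl (Γ₁.leg none)⟩, fun f hf => ?_⟩
    have h₁' := h₁ (fun a => f (.inl a)) fun j hj => hf (some (.inl j)) hj
    have h₂' := h₂ (fun a => f (.inr a)) fun j hj => hf (some (.inr j)) hj
    have h₀ : f (.inl (Γ₁.leg none)) ↔ f (.inr (Γ₂.leg none)) := hf none hE
    rintro (a | a) (b | b) ha
    · exact h₁' a b ha
    · exact h₂' _ b (h₀.1 (h₁' a _ ha))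
    · exact h₁' _ b (h₀.2 (h₂' a _ ha))
    · exact h₂' a b ha

theorem joinedBy_univ_glue (Γ₁ : LGraph P₁ Q₁ (Option L₁)) (Γ₂ : LGraph P₂ Q₂ (Option L₂)) :
    (glue Γ₁ Γ₂).JoinedBy Set.univ ↔ Γ₁.JoinedBy Set.univ ∧ Γ₂.JoinedBy Set.univ :=
  joinedBy_glue Γ₁ Γ₂ (Set.mem_univ _)

theorem isBridge_none_glue (Γ₁ : LGraph P₁ Q₁ (Option L₁)) (Γ₂ : LGraph P₂ Q₂ (Option L₂)) :
    (glue Γ₁ Γ₂).IsBridge none := by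
  rintro ⟨-, h⟩
  refine absurd (h (fun a => a.isLeft) ?_ (.inl (Γ₁.leg none)) (.inr (Γ₂.leg none)) rfl) (by simp)
  rintro (_ | j | j) hj
  · exact absurd rfl hj
  · simp [glue]
  · simp [glue]

/-- Cutting an old edge does not affect the other half, so bridges stay bridges and no others arise;
the new edge is the extra one. -/
theorem bridgeCount_glue [Fintype Q₁] [Fintype Q₂] {Γ₁ : LGraph P₁ Q₁ (Option L₁)}
    {Γ₂ : LGraph P₂ Q₂ (Option L₂)} (h₁ : Γ₁.JoinedBy Set.univ) (h₂ : Γ₂.JoinedBy Set.univ) :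
    (glue Γ₁ Γ₂).bridgeCount = Γ₁.bridgeCount + Γ₂.bridgeCount + 1 := by
  have hl (j : Q₁) : (glue Γ₁ Γ₂).IsBridge (some (.inl j)) ↔ Γ₁.IsBridge j := by
    rw [IsBridge, joinedBy_glue Γ₁ Γ₂ (by simp)]
    have e₁ : {i | (some (.inl i) : Option (Q₁ ⊕ Q₂)) ∈ ({some (.inl j)} : Set _)ᶜ} = {j}ᶜ := by
      ext; simp
    have e₂ : {i | (some (.inr i) : Option (Q₁ ⊕ Q₂)) ∈ ({some (.inl j)} : Set _)ᶜ} = Set.univ := by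
      ext; simp
    rw [e₁, e₂, and_iff_left h₂, IsBridge]
  have hr (j : Q₂) : (glue Γ₁ Γ₂).IsBridge (some (.inr j)) ↔ Γ₂.IsBridge j := by
    rw [IsBridge, joinedBy_glue Γ₁ Γ₂ (by simp)]
    have e₁ : {i | (some (.inr i) : Option (Q₁ ⊕ Q₂)) ∈ ({some (.inr j)} : Set _)ᶜ} = {j}ᶜ := by
      ext; simp
    have e₂ : {i | (some (.inl i) : Option (Q₁ ⊕ Q₂)) ∈ ({some (.inr j)} : Set _)ᶜ} = Set.univ := by
      ext; simp
    rw [e₁, e₂, and_iff_right h₁, IsBridge]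
  classical
  rw [bridgeCount, Fintype.sum_option, Fintype.sum_sum_type, if_pos (isBridge_none_glue Γ₁ Γ₂),
    Finset.sum_congr rfl fun j _ => if_congr (hl j) rfl rfl,
    Finset.sum_congr rfl fun j _ => if_congr (hr j) rfl rfl, add_comm]
  rfl

/-! ### Cutting a graph at a bridge -/

section Cut

/-- The vertices that the edges other than `none` connect to the start of the edge `none`. -/
def startSide (Γ : LGraph P (Option Q) L) (v : P) : Prop :=
  ∀ f : P → Prop, (∀ j : Q, f (Γ.src (some j)) ↔ f (Γ.tgt (some j))) → f (Γ.src none) → f v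

theorem startSide_src_iff (Γ : LGraph P (Option Q) L) (j : Q) :
    Γ.startSide (Γ.src (some j)) ↔ Γ.startSide (Γ.tgt (some j)) :=
  ⟨fun h f hf h0 => (hf j).1 (h f hf h0), fun h f hf h0 => (hf j).2 (h f hf h0)⟩

theorem startSide_src_none (Γ : LGraph P (Option Q) L) : Γ.startSide (Γ.src none) :=
  fun _ _ h => h

theorem joinedBy_compl_none_iff (Γ : LGraph P (Option Q) L) : Γ.JoinedBy {none}ᶜ ↔
    ∀ f : P → Prop, (∀ j : Q, f (Γ.src (some j)) ↔ f (Γ.tgt (some j))) → ∀ a b, f a → f b := by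
  constructor
  · rintro ⟨-, h⟩ f hf
    refine h f ?_
    rintro (_ | j) hj
    · exact absurd rfl hj
    · exact hf j
  · exact fun h => ⟨⟨Γ.src none⟩, fun f hf => h f fun j => hf (some j) (by simp)⟩

/-- Otherwise every predicate respected by the other edges would be respected by `none` as well, and
cutting `none` would not disconnect the graph. -/
theorem not_startSide_tgt_none {Γ : LGraph P (Option Q) L} (h : Γ.JoinedBy Set.univ)
    (hb : Γ.IsBridge none) : ¬ Γ.startSide (Γ.tgt none) := by
  intro ht
  refine hb ((joinedBy_compl_none_iff Γ).2 fun f hf => h.2 f ?_)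
  rintro (_ | j) -
  · refine ⟨ht f hf, fun h2 => ?_⟩
    -- The start side is defined by implications only; the converse direction comes from applying it
    -- to the complement of `f`.
    by_contra h1
    exact ht (fun v => ¬ f v) (fun j => not_congr (hf j)) h1 h2
  · exact hf j

variable [DecidableEq P] [DecidableEq Q] [DecidableEq L]

/-- The graph glued from a graph on the parts `S`, `T`, `I` of its vertices, edges and legs, and a
graph on the complements. -/
def glueAlong (S : Finset P) (T : Finset Q) (I : Finset L)
    (Γ : LGraph {v // v ∈ S} {j // j ∈ T} (Option {l // l ∈ I}) ×
      LGraph {v // v ∉ S} {j // j ∉ T} (Option {l // l ∉ I})) : LGraph P (Option Q) L :=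
  transport (Equiv.sumCompl (· ∈ S)) (Equiv.optionCongr (Equiv.sumCompl (· ∈ T)))
    (Equiv.sumCompl (· ∈ I)) (glue Γ.1 Γ.2)

variable {S : Finset P} {T : Finset Q} {I : Finset L}
  {Γ : LGraph {v // v ∈ S} {j // j ∈ T} (Option {l // l ∈ I}) ×
    LGraph {v // v ∉ S} {j // j ∉ T} (Option {l // l ∉ I})}

theorem glueAlong_src_none : (glueAlong S T I Γ).src none = Γ.1.leg none := rfl

theorem glueAlong_tgt_none : (glueAlong S T I Γ).tgt none = Γ.2.leg none := rfl

theorem glueAlong_src_of_mem {j : Q} (hj : j ∈ T) :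
    (glueAlong S T I Γ).src (some j) = Γ.1.src ⟨j, hj⟩ := by
  change Equiv.sumCompl (· ∈ S) (Sum.map Γ.1.src Γ.2.src ((Equiv.sumCompl (· ∈ T)).symm j)) = _
  rw [Equiv.sumCompl_symm_apply_of_pos hj]
  rfl

theorem glueAlong_src_of_notMem {j : Q} (hj : j ∉ T) :
    (glueAlong S T I Γ).src (some j) = Γ.2.src ⟨j, hj⟩ := by
  change Equiv.sumCompl (· ∈ S) (Sum.map Γ.1.src Γ.2.src ((Equiv.sumCompl (· ∈ T)).symm j)) = _
  rw [Equiv.sumCompl_symm_apply_of_neg hj]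
  rfl

theorem glueAlong_tgt_of_mem {j : Q} (hj : j ∈ T) :
    (glueAlong S T I Γ).tgt (some j) = Γ.1.tgt ⟨j, hj⟩ := by
  change Equiv.sumCompl (· ∈ S) (Sum.map Γ.1.tgt Γ.2.tgt ((Equiv.sumCompl (· ∈ T)).symm j)) = _
  rw [Equiv.sumCompl_symm_apply_of_pos hj]
  rfl

theorem glueAlong_tgt_of_notMem {j : Q} (hj : j ∉ T) :
    (glueAlong S T I Γ).tgt (some j) = Γ.2.tgt ⟨j, hj⟩ := by
  change Equiv.sumCompl (· ∈ S) (Sum.map Γ.1.tgt Γ.2.tgt ((Equiv.sumCompl (· ∈ T)).symm j)) = _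
  rw [Equiv.sumCompl_symm_apply_of_neg hj]
  rfl

theorem glueAlong_leg_of_mem {l : L} (hl : l ∈ I) :
    (glueAlong S T I Γ).leg l = Γ.1.leg (some ⟨l, hl⟩) := by
  simp [glueAlong, transport, glue, Equiv.sumCompl_symm_apply_of_pos hl]

theorem glueAlong_leg_of_notMem {l : L} (hl : l ∉ I) :
    (glueAlong S T I Γ).leg l = Γ.2.leg (some ⟨l, hl⟩) := by
  simp [glueAlong, transport, glue, Equiv.sumCompl_symm_apply_of_neg hl]

theorem glueAlong_src_mem_iff (j : Q) : (glueAlong S T I Γ).src (some j) ∈ S ↔ j ∈ T := by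
  by_cases hj : j ∈ T
  · simp [glueAlong_src_of_mem hj, hj]
  · simpa [glueAlong_src_of_notMem hj, hj] using (Γ.2.src ⟨j, hj⟩).2

theorem glueAlong_tgt_mem_iff (j : Q) : (glueAlong S T I Γ).tgt (some j) ∈ S ↔ j ∈ T := by
  by_cases hj : j ∈ T
  · simp [glueAlong_tgt_of_mem hj, hj]
  · simpa [glueAlong_tgt_of_notMem hj, hj] using (Γ.2.tgt ⟨j, hj⟩).2

theorem glueAlong_leg_mem_iff (l : L) : (glueAlong S T I Γ).leg l ∈ S ↔ l ∈ I := by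
  by_cases hl : l ∈ I
  · simp [glueAlong_leg_of_mem hl, hl]
  · simpa [glueAlong_leg_of_notMem hl, hl] using (Γ.2.leg (some ⟨l, hl⟩)).2

theorem glueAlong_injective (S : Finset P) (T : Finset Q) (I : Finset L) :
    Function.Injective (glueAlong S T I) := by
  intro Γ Γ' h
  refine Prod.ext (LGraph.ext ?_ ?_ ?_) (LGraph.ext ?_ ?_ ?_)
  · ext ⟨j, hj⟩
    rw [← glueAlong_src_of_mem, ← glueAlong_src_of_mem, h]
  · ext ⟨j, hj⟩
    rw [← glueAlong_tgt_of_mem, ← glueAlong_tgt_of_mem, h]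
  · ext (_ | ⟨l, hl⟩)
    · rw [← glueAlong_src_none, ← glueAlong_src_none, h]
    · rw [← glueAlong_leg_of_mem, ← glueAlong_leg_of_mem, h]
  · ext ⟨j, hj⟩
    rw [← glueAlong_src_of_notMem, ← glueAlong_src_of_notMem, h]
  · ext ⟨j, hj⟩
    rw [← glueAlong_tgt_of_notMem, ← glueAlong_tgt_of_notMem, h]
  · ext (_ | ⟨l, hl⟩)
    · rw [← glueAlong_tgt_none, ← glueAlong_tgt_none, h]
    · rw [← glueAlong_leg_of_notMem, ← glueAlong_leg_of_notMem, h]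

theorem joinedBy_univ_glueAlong : (glueAlong S T I Γ).JoinedBy Set.univ ↔
    Γ.1.JoinedBy Set.univ ∧ Γ.2.JoinedBy Set.univ := by
  rw [glueAlong, joinedBy_univ_transport, joinedBy_univ_glue]

theorem isBridge_none_glueAlong : (glueAlong S T I Γ).IsBridge none := by
  have := (isBridge_transport (Equiv.sumCompl (· ∈ S)) (Equiv.optionCongr (Equiv.sumCompl (· ∈ T)))
    (Equiv.sumCompl (· ∈ I)) (glue Γ.1 Γ.2) none).2 (isBridge_none_glue Γ.1 Γ.2)
  exact this

theorem bridgeCount_glueAlong [Fintype Q] (h₁ : Γ.1.JoinedBy Set.univ)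
    (h₂ : Γ.2.JoinedBy Set.univ) :
    (glueAlong S T I Γ).bridgeCount = Γ.1.bridgeCount + Γ.2.bridgeCount + 1 := by
  rw [glueAlong, bridgeCount_transport, bridgeCount_glue h₁ h₂]

/-- Shows that `S`, and with it `T` and `I`, can be recovered from the glued graph, so different
choices of parts yield different graphs. -/
theorem startSide_glueAlong (h : Γ.1.JoinedBy Set.univ) (v : P) :
    (glueAlong S T I Γ).startSide v ↔ v ∈ S := by
  constructor
  · intro hv
    refine hv (· ∈ S) (fun j => ?_) ?_
    · rw [glueAlong_src_mem_iff, glueAlong_tgt_mem_iff]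
    · rw [glueAlong_src_none]; exact (Γ.1.leg none).2
  · intro hv f hf h0
    rw [glueAlong_src_none] at h0
    refine h.2 (fun w => f w) (fun j _ => ?_) _ ⟨v, hv⟩ h0
    have := hf j.1
    rwa [glueAlong_src_of_mem j.2, glueAlong_tgt_of_mem j.2] at this

theorem exists_glueAlong_eq {Γ : LGraph P (Option Q) L} (h : Γ.JoinedBy Set.univ)
    (hb : Γ.IsBridge none) {S : Finset P} {T : Finset Q} {I : Finset L}
    (hS : ∀ v, v ∈ S ↔ Γ.startSide v) (hT : ∀ j, j ∈ T ↔ Γ.src (some j) ∈ S)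
    (hI : ∀ l, l ∈ I ↔ Γ.leg l ∈ S) :
    ∃ Γ', glueAlong S T I Γ' = Γ := by
  have hT' : ∀ j, j ∈ T ↔ Γ.tgt (some j) ∈ S := fun j => by
    rw [hT, hS, hS, startSide_src_iff]
  have h0 : Γ.src none ∈ S := (hS _).2 (startSide_src_none Γ)
  have h1 : Γ.tgt none ∉ S := fun hn => not_startSide_tgt_none h hb ((hS _).1 hn)
  refine ⟨(⟨fun j => ⟨Γ.src (some j.1), (hT _).1 j.2⟩, fun j => ⟨Γ.tgt (some j.1), (hT' _).1 j.2⟩,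
      fun l => l.elim ⟨Γ.src none, h0⟩ fun l => ⟨Γ.leg l.1, (hI _).1 l.2⟩⟩,
    ⟨fun j => ⟨Γ.src (some j.1), fun hn => j.2 ((hT _).2 hn)⟩,
      fun j => ⟨Γ.tgt (some j.1), fun hn => j.2 ((hT' _).2 hn)⟩,
      fun l => l.elim ⟨Γ.tgt none, h1⟩ fun l => ⟨Γ.leg l.1, fun hn => l.2 ((hI _).2 hn)⟩⟩), ?_⟩
  refine LGraph.ext (funext ?_) (funext ?_) (funext ?_)
  · rintro (_ | j)
    · rw [glueAlong_src_none]; rfl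
    · by_cases hj : j ∈ T
      · rw [glueAlong_src_of_mem hj]
      · rw [glueAlong_src_of_notMem hj]
  · rintro (_ | j)
    · rw [glueAlong_tgt_none]; rfl
    · by_cases hj : j ∈ T
      · rw [glueAlong_tgt_of_mem hj]
      · rw [glueAlong_tgt_of_notMem hj]
  · intro l
    by_cases hl : l ∈ I
    · rw [glueAlong_leg_of_mem hl]; rfl
    · rw [glueAlong_leg_of_notMem hl]; rfl

open Classical in
/-- A connected graph with the bridge `none` arises from exactly two connected graphs by gluing. -/
theorem sum_bridge_none [Fintype P] [Fintype Q] [Fintype L] {A : Type*} [AddCommMonoid A]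
    (F : LGraph P (Option Q) L → A) :
    ∑ Γ with JoinedBy Γ Set.univ ∧ Γ.IsBridge none, F Γ =
      ∑ S : Finset P, ∑ T : Finset Q, ∑ I : Finset L,
        ∑ Γ₁ : LGraph {v // v ∈ S} {j // j ∈ T} (Option {l // l ∈ I}) with Γ₁.JoinedBy Set.univ,
        ∑ Γ₂ : LGraph {v // v ∉ S} {j // j ∉ T} (Option {l // l ∉ I}) with Γ₂.JoinedBy Set.univ,
          F (glueAlong S T I (Γ₁, Γ₂)) := by
  -- The orientation of `none` makes the pair of halves ordered: the first one contains the source.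
  -- Its vertices, edges and legs index the fibres of the sum.
  let side (Γ : LGraph P (Option Q) L) : Finset P × Finset Q × Finset L :=
    (Finset.univ.filter Γ.startSide, Finset.univ.filter fun j => Γ.startSide (Γ.src (some j)),
      Finset.univ.filter fun l => Γ.startSide (Γ.leg l))
  rw [← Finset.sum_fiberwise _ side]
  simp only [Fintype.sum_prod_type]
  refine Finset.sum_congr rfl fun S _ => Finset.sum_congr rfl fun T _ =>
    Finset.sum_congr rfl fun I _ => ?_
  rw [← Finset.sum_product']
  refine (Finset.sum_nbij (glueAlong S T I) ?_ (glueAlong_injective S T I).injOn ?_ ?_).symm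
  · rintro Γ hΓ
    simp only [Finset.mem_product, Finset.mem_filter, Finset.mem_univ, true_and] at hΓ
    simp only [Finset.mem_filter, Finset.mem_univ, true_and]
    refine ⟨⟨joinedBy_univ_glueAlong.2 hΓ, isBridge_none_glueAlong⟩, ?_⟩
    refine Prod.ext ?_ (Prod.ext ?_ ?_)
    · ext v; simp [side, startSide_glueAlong hΓ.1]
    · ext j; simp [side, startSide_glueAlong hΓ.1, glueAlong_src_mem_iff]
    · ext l; simp [side, startSide_glueAlong hΓ.1, glueAlong_leg_mem_iff]
  · rintro Γ hΓ
    simp only [Finset.coe_filter, Finset.mem_filter, Finset.mem_univ, true_and,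
      Set.mem_ofPred_eq] at hΓ
    obtain ⟨⟨h, hb⟩, hs⟩ := hΓ
    obtain ⟨rfl, hs'⟩ := Prod.ext_iff.1 hs
    obtain ⟨rfl, rfl⟩ := Prod.ext_iff.1 hs'
    obtain ⟨Γ', hΓ'⟩ := exists_glueAlong_eq (S := (side Γ).1) (T := (side Γ).2.1)
      (I := (side Γ).2.2) h hb (by simp [side]) (by simp [side]) (by simp [side])
    refine ⟨Γ', ?_, hΓ'⟩
    rw [← hΓ', joinedBy_univ_glueAlong] at h
    simpa using h
  · exact fun _ _ => rfl

end Cut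

end LGraph

/-! ### Sums over labellings -/

theorem sum_option_arrow {α X A : Type*} [Fintype α] [DecidableEq α] [Fintype X] [AddCommMonoid A]
    (F : (Option α → X) → A) :
    ∑ f, F f = ∑ x : X, ∑ f : α → X, F fun o => o.elim x f := by
  rw [← Fintype.sum_prod_type' (f := fun x (f : α → X) => F fun o => o.elim x f)]
  refine Fintype.sum_equiv
    ⟨fun f => (f none, fun a => f (some a)), fun p o => o.elim p.1 p.2, ?_, ?_⟩ _ _ ?_
  · intro f; ext (_ | a) <;> rfl
  · intro p; rfl
  · intro f; congr 1; ext (_ | a) <;> rfl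

theorem sum_sum_arrow {α β X A : Type*} [Fintype α] [DecidableEq α] [Fintype β] [DecidableEq β]
    [Fintype X] [AddCommMonoid A] (F : (α ⊕ β → X) → A) :
    ∑ f, F f = ∑ f : α → X, ∑ g : β → X, F (Sum.elim f g) := by
  rw [← Fintype.sum_prod_type' (f := fun (f : α → X) (g : β → X) => F (Sum.elim f g))]
  refine Fintype.sum_equiv (Equiv.sumArrowEquivProdArrow α β X) _ _ fun f => ?_
  simp [Equiv.sumArrowEquivProdArrow]

namespace LGraph

variable {P Q L P' Q' L' P₁ P₂ Q₁ Q₂ L₁ L₂ : Type*}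
  [Fintype P] [Fintype Q] [Fintype L] [DecidableEq P] [DecidableEq Q] [DecidableEq L]
  [Fintype P'] [Fintype Q'] [Fintype L'] [DecidableEq P'] [DecidableEq Q'] [DecidableEq L']
  [Fintype P₁] [Fintype Q₁] [Fintype L₁] [DecidableEq P₁] [DecidableEq Q₁] [DecidableEq L₁]
  [Fintype P₂] [Fintype Q₂] [Fintype L₂] [DecidableEq P₂] [DecidableEq Q₂] [DecidableEq L₂]
  {X : Type u} [Fintype X] {A : Type v} [CommRing A] [Algebra ℂ A]

/-- The product of the field operators of the edge ends at the vertex `i`. -/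
def vertexOp (Γ : LGraph P Q L) (a b : Q → X) (c : L → X) (i : P) : FieldAlg X :=
  (∏ j with Γ.src j = i, phi (a j)) * (∏ j with Γ.tgt j = i, phi (b j)) *
    ∏ l with Γ.leg l = i, phi (c l)

/-- The value of a graph by the Feynman rules. -/
def val (G : Matrix X X ℂ) (ν : FieldAlg X →ₗ[ℂ] A) (Γ : LGraph P Q L) (x : L → X) : A :=
  ∑ a : Q → X, ∑ b : Q → X, ∑ c : L → X,
    ((∏ j, G (a j) (b j)) * ∏ l, G (x l) (c l)) • ∏ i, ν (Γ.vertexOp a b c i)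

theorem val_transport (G : Matrix X X ℂ) (ν : FieldAlg X →ₗ[ℂ] A) (eP : P ≃ P') (eQ : Q ≃ Q')
    (eL : L ≃ L') (Γ : LGraph P Q L) (x : L' → X) :
    (transport eP eQ eL Γ).val G ν x = Γ.val G ν (x ∘ eL) := by
  unfold val
  rw [← (Equiv.arrowCongr eQ (Equiv.refl X)).sum_comp]
  refine Finset.sum_congr rfl fun a _ => ?_
  rw [← (Equiv.arrowCongr eQ (Equiv.refl X)).sum_comp]
  refine Finset.sum_congr rfl fun b _ => ?_
  rw [← (Equiv.arrowCongr eL (Equiv.refl X)).sum_comp]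
  refine Finset.sum_congr rfl fun c _ => ?_
  rw [← eQ.prod_comp, ← eL.prod_comp, ← eP.prod_comp]
  congr 1
  · simp
  · refine Finset.prod_congr rfl fun i _ => ?_
    simp only [vertexOp, Finset.prod_filter]
    rw [← eQ.prod_comp, ← eQ.prod_comp, ← eL.prod_comp]
    simp [transport]

/-- The value of a graph without the propagator of the leg `none`, whose inner label is `u`. -/
def ampVal (G : Matrix X X ℂ) (ν : FieldAlg X →ₗ[ℂ] A) (Γ : LGraph P Q (Option L)) (x : L → X)
    (u : X) : A :=
  ∑ a : Q → X, ∑ b : Q → X, ∑ c : L → X,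
    ((∏ j, G (a j) (b j)) * ∏ l, G (x l) (c l)) • ∏ i, ν (Γ.vertexOp a b (fun l => l.elim u c) i)

theorem val_option (G : Matrix X X ℂ) (ν : FieldAlg X →ₗ[ℂ] A) (Γ : LGraph P Q (Option L))
    (x : L → X) (y : X) :
    Γ.val G ν (fun l => l.elim y x) = ∑ u, G y u • Γ.ampVal G ν x u := by
  unfold val ampVal
  simp only [sum_option_arrow, Fintype.prod_option, Finset.smul_sum, smul_smul, Option.elim_none,
    Option.elim_some]
  rw [Finset.sum_congr rfl fun a _ => Finset.sum_comm, Finset.sum_comm]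
  refine Finset.sum_congr rfl fun u _ => Finset.sum_congr rfl fun a _ =>
    Finset.sum_congr rfl fun b _ => Finset.sum_congr rfl fun c _ => ?_
  congr 1
  ring

theorem vertexOp_glue_inl (Γ₁ : LGraph P₁ Q₁ (Option L₁)) (Γ₂ : LGraph P₂ Q₂ (Option L₂))
    (u v : X) (a₁ b₁ : Q₁ → X) (a₂ b₂ : Q₂ → X) (c₁ : L₁ → X) (c₂ : L₂ → X) (i : P₁) :
    (glue Γ₁ Γ₂).vertexOp (fun o => o.elim u (Sum.elim a₁ a₂)) (fun o => o.elim v (Sum.elim b₁ b₂))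
      (Sum.elim c₁ c₂) (.inl i) = Γ₁.vertexOp a₁ b₁ (fun l => l.elim u c₁) i := by
  simp only [vertexOp, Finset.prod_filter, Fintype.prod_option, Fintype.prod_sum_type]
  simp only [glue, Option.elim_none, Option.elim_some, Sum.map_inl, Sum.map_inr, Sum.elim_inl,
    Sum.elim_inr, Sum.inl.injEq, reduceCtorEq, if_false, Finset.prod_const_one, mul_one, one_mul]
  ring

theorem vertexOp_glue_inr (Γ₁ : LGraph P₁ Q₁ (Option L₁)) (Γ₂ : LGraph P₂ Q₂ (Option L₂))
    (u v : X) (a₁ b₁ : Q₁ → X) (a₂ b₂ : Q₂ → X) (c₁ : L₁ → X) (c₂ : L₂ → X) (i : P₂) :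
    (glue Γ₁ Γ₂).vertexOp (fun o => o.elim u (Sum.elim a₁ a₂)) (fun o => o.elim v (Sum.elim b₁ b₂))
      (Sum.elim c₁ c₂) (.inr i) = Γ₂.vertexOp a₂ b₂ (fun l => l.elim v c₂) i := by
  simp only [vertexOp, Finset.prod_filter, Fintype.prod_option, Fintype.prod_sum_type]
  simp only [glue, Option.elim_none, Option.elim_some, Sum.map_inl, Sum.map_inr, Sum.elim_inl,
    Sum.elim_inr, Sum.inr.injEq, reduceCtorEq, if_false, Finset.prod_const_one, one_mul]
  ring

/-- Once the labels `u`, `v` at the ends of the new edge are fixed, the Feynman rules factor over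
the two halves. -/
theorem val_glue_eq_ampVal (G : Matrix X X ℂ) (ν : FieldAlg X →ₗ[ℂ] A)
    (Γ₁ : LGraph P₁ Q₁ (Option L₁)) (Γ₂ : LGraph P₂ Q₂ (Option L₂)) (x : L₁ ⊕ L₂ → X) :
    (glue Γ₁ Γ₂).val G ν x =
      ∑ u, ∑ v, G u v • (Γ₁.ampVal G ν (x ∘ .inl) u * Γ₂.ampVal G ν (x ∘ .inr) v) := by
  have key (u v : X) (a₁ b₁ : Q₁ → X) (a₂ b₂ : Q₂ → X) (c₁ : L₁ → X) (c₂ : L₂ → X) :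
      ((∏ j, G ((fun o : Option (Q₁ ⊕ Q₂) => o.elim u (Sum.elim a₁ a₂)) j)
          ((fun o : Option (Q₁ ⊕ Q₂) => o.elim v (Sum.elim b₁ b₂)) j)) *
        ∏ l, G (x l) (Sum.elim c₁ c₂ l)) •
        ∏ i, ν ((glue Γ₁ Γ₂).vertexOp (fun o => o.elim u (Sum.elim a₁ a₂))
          (fun o => o.elim v (Sum.elim b₁ b₂)) (Sum.elim c₁ c₂) i) =
      G u v • ((((∏ j, G (a₁ j) (b₁ j)) * ∏ l, G (x (.inl l)) (c₁ l)) •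
          ∏ i, ν (Γ₁.vertexOp a₁ b₁ (fun l => l.elim u c₁) i)) *
        (((∏ j, G (a₂ j) (b₂ j)) * ∏ l, G (x (.inr l)) (c₂ l)) •
          ∏ i, ν (Γ₂.vertexOp a₂ b₂ (fun l => l.elim v c₂) i))) := by
    simp only [Fintype.prod_sum_type, Fintype.prod_option, vertexOp_glue_inl, vertexOp_glue_inr,
      Option.elim_none, Option.elim_some, Sum.elim_inl, Sum.elim_inr, smul_mul_smul_comm, smul_smul]
    congr 1
    ring
  unfold val ampVal
  simp only [sum_option_arrow, sum_sum_arrow]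
  simp only [key, Function.comp_apply]
  refine Finset.sum_congr rfl fun u _ => ?_
  simp only [Finset.sum_mul_sum, Finset.smul_sum]
  rw [Finset.sum_comm (s := (Finset.univ : Finset X))]
  refine Finset.sum_congr rfl fun a₁ _ => ?_
  rw [Finset.sum_comm (s := (Finset.univ : Finset X))]

theorem sum_inv_mul_mul [DecidableEq X] {G : Matrix X X ℂ} (hG : G.IsSymm) (hG' : IsUnit G.det)
    (u v : X) : ∑ y, ∑ z, G⁻¹ y z * (G y u * G z v) = G u v := by
  have h : (G.transpose * G⁻¹ * G) u v = G u v := by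
    rw [hG.eq, Matrix.mul_nonsing_inv _ hG', one_mul]
  rw [← h, Matrix.mul_assoc, Matrix.mul_apply]
  refine Finset.sum_congr rfl fun y _ => ?_
  rw [Matrix.mul_apply, Finset.mul_sum]
  refine Finset.sum_congr rfl fun z _ => ?_
  rw [Matrix.transpose_apply]
  ring

/-- Two external legs carry two propagators where the internal edge has one; `G⁻¹` in between
compensates because `G G⁻¹ G = G`. This is the origin of `R`. -/
theorem val_glue [DecidableEq X] {G : Matrix X X ℂ} (hG : G.IsSymm) (hG' : IsUnit G.det)
    (ν : FieldAlg X →ₗ[ℂ] A) (Γ₁ : LGraph P₁ Q₁ (Option L₁)) (Γ₂ : LGraph P₂ Q₂ (Option L₂))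
    (x : L₁ ⊕ L₂ → X) :
    (glue Γ₁ Γ₂).val G ν x = ∑ y, ∑ z, G⁻¹ y z •
      (Γ₁.val G ν (fun l => l.elim y (x ∘ .inl)) * Γ₂.val G ν (fun l => l.elim z (x ∘ .inr))) := by
  simp only [val_glue_eq_ampVal, val_option, Finset.sum_mul_sum, Finset.smul_sum,
    smul_mul_smul_comm, smul_smul]
  symm
  rw [Finset.sum_congr rfl fun y _ => Finset.sum_comm, Finset.sum_comm]
  refine Finset.sum_congr rfl fun u _ => ?_
  rw [Finset.sum_congr rfl fun y _ => Finset.sum_comm, Finset.sum_comm]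
  refine Finset.sum_congr rfl fun v _ => ?_
  simp only [← Finset.sum_smul, sum_inv_mul_mul hG hG']

end LGraph

/-! ### Sums over connected graphs with a given number of bridges -/

open Finset.HasAntidiagonal (antidiagonal)

namespace LGraph

variable {X : Type u} [Fintype X] {A : Type v} [CommRing A] [Algebra ℂ A]

section BridgeSum

variable (P Q L : Type*) {P' Q' L' : Type*}
  [Fintype P'] [Fintype Q'] [Fintype L'] [DecidableEq P'] [DecidableEq Q'] [DecidableEq L']
  [Fintype P] [Fintype Q] [Fintype L] [DecidableEq P] [DecidableEq Q] [DecidableEq L]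

open Classical in
/-- The sum of the values of all connected graphs on `P`, `Q`, `L` with exactly `b` bridges. -/
def bridgeSum (G : Matrix X X ℂ) (ν : FieldAlg X →ₗ[ℂ] A) (b : ℕ) (x : L → X) : A :=
  ∑ Γ : LGraph P Q L with Γ.JoinedBy Set.univ ∧ Γ.bridgeCount = b, Γ.val G ν x

variable {P Q L}

theorem bridgeSum_congr (G : Matrix X X ℂ) (ν : FieldAlg X →ₗ[ℂ] A) (b : ℕ) (eP : P ≃ P')
    (eQ : Q ≃ Q') (eL : L ≃ L') (x : L' → X) :
    bridgeSum P' Q' L' G ν b x = bridgeSum P Q L G ν b (x ∘ eL) := by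
  classical
  unfold bridgeSum
  rw [Finset.sum_filter, Finset.sum_filter, ← (transport eP eQ eL).sum_comp]
  refine Finset.sum_congr rfl fun Γ _ => if_congr ?_ (val_transport ..) rfl
  rw [joinedBy_univ_transport, bridgeCount_transport]

theorem bridgeSum_of_card_lt (G : Matrix X X ℂ) (ν : FieldAlg X →ₗ[ℂ] A) {b : ℕ}
    (h : Fintype.card Q < b) (x : L → X) : bridgeSum P Q L G ν b x = 0 := by
  classical
  refine Finset.sum_eq_zero fun Γ hΓ => ?_
  have := (Finset.mem_filter.1 hΓ).2.2
  have := Γ.bridgeCount_le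
  omega

theorem val_glueAlong [DecidableEq X] {G : Matrix X X ℂ} (hG : G.IsSymm) (hG' : IsUnit G.det)
    (ν : FieldAlg X →ₗ[ℂ] A) (S : Finset P) (T : Finset Q) (I : Finset L)
    (Γ : LGraph {v // v ∈ S} {j // j ∈ T} (Option {l // l ∈ I}) ×
      LGraph {v // v ∉ S} {j // j ∉ T} (Option {l // l ∉ I})) (x : L → X) :
    (glueAlong S T I Γ).val G ν x = ∑ y, ∑ z, G⁻¹ y z •
      (Γ.1.val G ν (fun l => l.elim y fun l => x l) *
        Γ.2.val G ν (fun l => l.elim z fun l => x l)) := by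
  rw [glueAlong, val_transport, val_glue hG hG']
  rfl

-- Double counting of pairs of a graph and one of its bridges. Transposing an edge with `none`
-- preserves values and bridge numbers, so all edges contribute equally.
open Classical in
theorem nsmul_bridgeSum_eq_sum_bridge_none (G : Matrix X X ℂ) (ν : FieldAlg X →ₗ[ℂ] A) (b : ℕ)
    (x : L → X) :
    b • bridgeSum P (Option Q) L G ν b x = (Fintype.card Q + 1) •
      ∑ Γ : LGraph P (Option Q) L with Γ.JoinedBy Set.univ ∧ Γ.IsBridge none,
        if Γ.bridgeCount = b then Γ.val G ν x else 0 := by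
  have h1 : b • bridgeSum P (Option Q) L G ν b x =
      ∑ j : Option Q, ∑ Γ : LGraph P (Option Q) L with Γ.JoinedBy Set.univ ∧ Γ.IsBridge j,
        if Γ.bridgeCount = b then Γ.val G ν x else 0 := by
    simp only [Finset.sum_filter]
    rw [Finset.sum_comm, bridgeSum, Finset.sum_filter, Finset.smul_sum]
    refine Finset.sum_congr rfl fun Γ _ => ?_
    by_cases hJ : Γ.JoinedBy Set.univ
    · by_cases hb : Γ.bridgeCount = b
      · simp only [hJ, hb, true_and, and_self, if_true]
        rw [← hb, bridgeCount, Finset.sum_smul]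
        refine Finset.sum_congr rfl fun j _ => ?_
        split_ifs <;> simp
      · simp [hb]
    · simp [hJ]
  rw [h1]
  have h2 (j : Option Q) :
      (∑ Γ : LGraph P (Option Q) L with Γ.JoinedBy Set.univ ∧ Γ.IsBridge j,
        if Γ.bridgeCount = b then Γ.val G ν x else 0) =
      ∑ Γ : LGraph P (Option Q) L with Γ.JoinedBy Set.univ ∧ Γ.IsBridge none,
        if Γ.bridgeCount = b then Γ.val G ν x else 0 := by
    rw [Finset.sum_filter, Finset.sum_filter,
      ← (transport (Equiv.refl P) (Equiv.swap none j) (Equiv.refl L)).sum_comp]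
    refine Finset.sum_congr rfl fun Γ _ => if_congr ?_ (if_congr ?_ ?_ rfl) rfl
    · rw [joinedBy_univ_transport]
      have := isBridge_transport (Equiv.refl P) (Equiv.swap none j) (Equiv.refl L) Γ none
      rw [Equiv.swap_apply_left] at this
      rw [this]
    · rw [bridgeCount_transport]
    · rw [val_transport]; rfl
  rw [Finset.sum_congr rfl fun j _ => h2 j, Finset.sum_const, Finset.card_univ,
    Fintype.card_option]

/-- Cutting a marked bridge. -/
theorem bridgeSum_succ [DecidableEq X] {G : Matrix X X ℂ} (hG : G.IsSymm) (hG' : IsUnit G.det)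
    (ν : FieldAlg X →ₗ[ℂ] A) (b : ℕ) (x : L → X) :
    (b + 1) • bridgeSum P (Option Q) L G ν (b + 1) x = (Fintype.card Q + 1) •
      ∑ S : Finset P, ∑ T : Finset Q, ∑ I : Finset L, ∑ ab ∈ antidiagonal b,
        ∑ y, ∑ z, G⁻¹ y z •
          (bridgeSum {v // v ∈ S} {j // j ∈ T} (Option {l // l ∈ I}) G ν ab.1
              (fun l => l.elim y fun l => x l) *
            bridgeSum {v // v ∉ S} {j // j ∉ T} (Option {l // l ∉ I}) G ν ab.2
              (fun l => l.elim z fun l => x l)) := by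
  classical
  rw [nsmul_bridgeSum_eq_sum_bridge_none]
  congr 1
  rw [sum_bridge_none]
  refine Finset.sum_congr rfl fun S _ => Finset.sum_congr rfl fun T _ =>
    Finset.sum_congr rfl fun I _ => ?_
  -- Fixing the bridge numbers of the halves by an indicator lets the sum over `antidiagonal b`
  -- select, for each pair of halves, the one matching term.
  have h (a c : ℕ) :
      ∑ y, ∑ z, G⁻¹ y z •
          (bridgeSum {v // v ∈ S} {j // j ∈ T} (Option {l // l ∈ I}) G ν a
              (fun l => l.elim y fun l => x l) *
            bridgeSum {v // v ∉ S} {j // j ∉ T} (Option {l // l ∉ I}) G ν c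
              (fun l => l.elim z fun l => x l)) =
      ∑ Γ₁ : LGraph {v // v ∈ S} {j // j ∈ T} (Option {l // l ∈ I}) with Γ₁.JoinedBy Set.univ,
        ∑ Γ₂ : LGraph {v // v ∉ S} {j // j ∉ T} (Option {l // l ∉ I}) with Γ₂.JoinedBy Set.univ,
          if (Γ₁.bridgeCount, Γ₂.bridgeCount) = (a, c) then
            (glueAlong S T I (Γ₁, Γ₂)).val G ν x else 0 := by
    simp only [bridgeSum, Finset.sum_mul_sum, Finset.smul_sum, ← Finset.filter_filter]
    rw [Finset.sum_congr rfl fun y _ => Finset.sum_comm, Finset.sum_comm, Finset.sum_filter]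
    refine Finset.sum_congr rfl fun Γ₁ _ => ?_
    rw [Finset.sum_congr rfl fun y _ => Finset.sum_comm, Finset.sum_comm, Finset.sum_filter]
    split_ifs with h₁
    · refine Finset.sum_congr rfl fun Γ₂ _ => ?_
      simp [h₁, val_glueAlong hG hG']
    · simp [h₁]
  simp only [h]
  symm
  rw [Finset.sum_comm]
  refine Finset.sum_congr rfl fun Γ₁ h₁ => ?_
  rw [Finset.sum_comm]
  refine Finset.sum_congr rfl fun Γ₂ h₂ => ?_
  rw [Finset.sum_ite_eq,
    bridgeCount_glueAlong (Finset.mem_filter.1 h₁).2 (Finset.mem_filter.1 h₂).2]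
  simp

end BridgeSum

end LGraph

/-! ### Symmetry factors -/

theorem sum_finset_card {p : ℕ} {M : Type*} [AddCommMonoid M] (f : ℕ → ℕ → M) :
    ∑ S : Finset (Fin p), f S.card (p - S.card) =
      ∑ m ∈ antidiagonal p, p.choose m.1 • f m.1 m.2 := by
  rw [Finset.Nat.sum_antidiagonal_eq_sum_range_succ (fun i j => p.choose i • f i j),
    ← Finset.powerset_univ, Finset.sum_powerset_apply_card (fun m => f m (p - m))]
  simp

namespace LGraph

variable {X : Type u} [Fintype X] {A : Type v} [CommRing A] [Algebra ℂ A]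

/-- The sum, with symmetry factors, of the values of all connected graphs with `p` vertices, `q`
edges, set of legs `L` and exactly `b` bridges. -/
def sizeSum (L : Type*) [Fintype L] [DecidableEq L] (G : Matrix X X ℂ) (ν : FieldAlg X →ₗ[ℂ] A)
    (b : ℕ) (x : L → X) (p q : ℕ) : A :=
  (1 / ((p.factorial : ℂ) * (q.factorial : ℂ) * 2 ^ q)) • bridgeSum (Fin p) (Fin q) L G ν b x

variable {L L' : Type*} [Fintype L] [DecidableEq L] [Fintype L'] [DecidableEq L']

theorem sizeSum_congr (G : Matrix X X ℂ) (ν : FieldAlg X →ₗ[ℂ] A) (b : ℕ) (e : L ≃ L')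
    (x : L' → X) (p q : ℕ) : sizeSum L' G ν b x p q = sizeSum L G ν b (x ∘ e) p q := by
  rw [sizeSum, bridgeSum_congr G ν b (Equiv.refl _) (Equiv.refl _) e, sizeSum]

theorem sizeSum_of_lt (G : Matrix X X ℂ) (ν : FieldAlg X →ₗ[ℂ] A) {b : ℕ}
    (x : L → X) (p : ℕ) {q : ℕ} (h : q < b) : sizeSum L G ν b x p q = 0 := by
  rw [sizeSum, bridgeSum_of_card_lt _ _ (by simpa using h), smul_zero]

theorem symmFactor_ne_zero (p q : ℕ) : (p.factorial : ℂ) * (q.factorial : ℂ) * 2 ^ q ≠ 0 := by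
  simp [Nat.factorial_ne_zero]

theorem bridgeSum_eq_sizeSum {P Q : Type*} [Fintype P] [Fintype Q] [DecidableEq P] [DecidableEq Q]
    (G : Matrix X X ℂ) (ν : FieldAlg X →ₗ[ℂ] A) (b : ℕ) (x : L → X) {p q : ℕ}
    (hp : Fintype.card P = p) (hq : Fintype.card Q = q) :
    bridgeSum P Q L G ν b x =
      ((p.factorial : ℂ) * (q.factorial : ℂ) * 2 ^ q) • sizeSum L G ν b x p q := by
  rw [sizeSum, smul_smul, mul_one_div_cancel (symmFactor_ne_zero p q), one_smul]
  exact bridgeSum_congr G ν b (Fintype.equivFinOfCardEq hp).symm (Fintype.equivFinOfCardEq hq).symm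
    (Equiv.refl L) x

/-- The choices of subsets of vertices and edges give binomials that absorb the factorials of the
halves, and the choice of the marked edge gives `q + 1`. The halves have together one edge less,
hence one power of two less: this is the factor `1/2`. -/
theorem sizeSum_succ [DecidableEq X] {G : Matrix X X ℂ} (hG : G.IsSymm) (hG' : IsUnit G.det)
    (ν : FieldAlg X →ₗ[ℂ] A) (b : ℕ) (x : L → X) (p q : ℕ) :
    (b + 1) • sizeSum L G ν (b + 1) x p (q + 1) = (1 / 2 : ℂ) •
      ∑ m ∈ antidiagonal p, ∑ r ∈ antidiagonal q, ∑ I : Finset L, ∑ ab ∈ antidiagonal b,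
        ∑ y, ∑ z, G⁻¹ y z •
          (sizeSum (Option {l // l ∈ I}) G ν ab.1 (fun l => l.elim y fun l => x l) m.1 r.1 *
            sizeSum (Option {l // l ∉ I}) G ν ab.2 (fun l => l.elim z fun l => x l) m.2 r.2) := by
  have h1 (S : Finset (Fin p)) (T : Finset (Fin q)) (I : Finset L) (ab : ℕ × ℕ) (y z : X) :
      G⁻¹ y z • (bridgeSum {v // v ∈ S} {j // j ∈ T} (Option {l // l ∈ I}) G ν ab.1
              (fun l => l.elim y fun l => x l) *
            bridgeSum {v // v ∉ S} {j // j ∉ T} (Option {l // l ∉ I}) G ν ab.2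
              (fun l => l.elim z fun l => x l)) =
      ((S.card.factorial : ℂ) * ((p - S.card).factorial : ℂ)) •
        (((T.card.factorial : ℂ) * ((q - T.card).factorial : ℂ) * 2 ^ q) • G⁻¹ y z •
          (sizeSum (Option {l // l ∈ I}) G ν ab.1 (fun l => l.elim y fun l => x l) S.card T.card *
            sizeSum (Option {l // l ∉ I}) G ν ab.2 (fun l => l.elim z fun l => x l)
              (p - S.card) (q - T.card))) := by
    -- Truncated subtraction is harmless as `T` is a subset of `Fin q`; this merges the two powers
    -- of two.
    have hT : T.card + (q - T.card) = q := by
      have := T.card_le_univ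
      rw [Fintype.card_fin] at this
      omega
    rw [bridgeSum_eq_sizeSum (p := S.card) (q := T.card) _ _ _ _ (by simp) (by simp),
      bridgeSum_eq_sizeSum (p := p - S.card) (q := q - T.card) _ _ _ _
        (by simp [Fintype.card_subtype_compl]) (by simp [Fintype.card_subtype_compl])]
    rw [smul_mul_smul_comm]
    simp only [smul_smul]
    congr 1
    have h2 : (2 : ℂ) ^ q = 2 ^ T.card * 2 ^ (q - T.card) := by rw [← pow_add, hT]
    rw [h2]
    ring
  have h2 := bridgeSum_succ (P := Fin p) (Q := Fin q) hG hG' ν b x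
  simp only [h1, ← Finset.smul_sum] at h2
  rw [bridgeSum_eq_sizeSum (p := p) (q := q + 1) _ _ _ _ (by simp) (by simp), Fintype.card_fin] at h2
  rw [sum_finset_card fun m m' => ((m.factorial : ℂ) * (m'.factorial : ℂ)) •
    ∑ T : Finset (Fin q), ((T.card.factorial : ℂ) * ((q - T.card).factorial : ℂ) * 2 ^ q) •
      ∑ I : Finset L, ∑ ab ∈ antidiagonal b, ∑ y, ∑ z, G⁻¹ y z •
          (sizeSum (Option {l // l ∈ I}) G ν ab.1 (fun l => l.elim y fun l => x l) m T.card *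
            sizeSum (Option {l // l ∉ I}) G ν ab.2 (fun l => l.elim z fun l => x l)
              m' (q - T.card))] at h2
  have h3 (m : ℕ × ℕ) := sum_finset_card (p := q) fun r r' =>
      ((r.factorial : ℂ) * (r'.factorial : ℂ) * 2 ^ q) •
      ∑ I : Finset L, ∑ ab ∈ antidiagonal b, ∑ y, ∑ z, G⁻¹ y z •
          (sizeSum (Option {l // l ∈ I}) G ν ab.1 (fun l => l.elim y fun l => x l) m.1 r *
            sizeSum (Option {l // l ∉ I}) G ν ab.2 (fun l => l.elim z fun l => x l)
              m.2 r')
  simp only [h3] at h2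
  have hch (n : ℕ) (m : ℕ × ℕ) (hm : m ∈ antidiagonal n) :
      (n.choose m.1 : ℂ) * ((m.1.factorial : ℂ) * (m.2.factorial : ℂ)) = n.factorial := by
    rw [Finset.HasAntidiagonal.mem_antidiagonal] at hm
    subst hm
    have := Nat.add_choose_mul_factorial_mul_factorial m.1 m.2
    rw [← this, ← Nat.choose_symm_add]; push_cast; ring
  have h4 : (b + 1) • ((p.factorial : ℂ) * ((q + 1).factorial : ℂ) * 2 ^ (q + 1)) •
      sizeSum L G ν (b + 1) x p (q + 1) =
    ((p.factorial : ℂ) * ((q + 1).factorial : ℂ) * 2 ^ q) •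
      ∑ m ∈ antidiagonal p, ∑ r ∈ antidiagonal q, ∑ I : Finset L, ∑ ab ∈ antidiagonal b,
        ∑ y, ∑ z, G⁻¹ y z •
          (sizeSum (Option {l // l ∈ I}) G ν ab.1 (fun l => l.elim y fun l => x l) m.1 r.1 *
            sizeSum (Option {l // l ∉ I}) G ν ab.2 (fun l => l.elim z fun l => x l) m.2 r.2) := by
    rw [h2, Finset.smul_sum, Finset.smul_sum]
    refine Finset.sum_congr rfl fun m hm => ?_
    simp only [Finset.smul_sum (s := antidiagonal q)]
    refine Finset.sum_congr rfl fun r hr => ?_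
    simp only [← Nat.cast_smul_eq_nsmul ℂ, smul_smul]
    congr 1
    rw [← hch p m hm, Nat.factorial_succ, Nat.cast_mul, ← hch q r hr]
    ring
  rw [smul_comm] at h4
  have h5 := congrArg
    (fun a => (1 / ((p.factorial : ℂ) * ((q + 1).factorial : ℂ) * 2 ^ (q + 1))) • a) h4
  simp only [smul_smul] at h5
  rw [one_div_mul_cancel (symmFactor_ne_zero p (q + 1)), one_smul] at h5
  rw [h5]
  congr 1
  have := (p.factorial_ne_zero)
  have := ((q + 1).factorial_ne_zero)
  field_simp
  ring

end LGraph

/-! ### Locally finite sums of power series -/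

section LocallyFinite

open scoped MvPowerSeries.WithPiTopology

variable {J ι κ : Type*}

/-- Each monomial occurs in only finitely many members of the family. -/
def LocFin (f : ι → MvPowerSeries J ℂ) : Prop :=
  ∀ d, {i | MvPowerSeries.coeff d (f i) ≠ 0}.Finite

theorem LocFin.summable {f : ι → MvPowerSeries J ℂ} (hf : LocFin f) : Summable f :=
  MvPowerSeries.WithPiTopology.summable_iff_summable_coeff.2 fun d =>
    summable_of_hasFiniteSupport (hf d)

theorem LocFin.coeff_tsum {f : ι → MvPowerSeries J ℂ} (hf : LocFin f) (d : J →₀ ℕ) :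
    MvPowerSeries.coeff d (∑' i, f i) = ∑ᶠ i, MvPowerSeries.coeff d (f i) := by
  rw [← tsum_eq_finsum (L := .unconditional ι) (hf d)]
  exact ((MvPowerSeries.WithPiTopology.hasSum_iff_hasSum_coeff.1 hf.summable.hasSum) d).tsum_eq.symm

theorem LocFin.mul {f : ι → MvPowerSeries J ℂ} {g : κ → MvPowerSeries J ℂ} (hf : LocFin f)
    (hg : LocFin g) : LocFin fun p : ι × κ => f p.1 * g p.2 := by
  classical
  intro d
  refine Set.Finite.subset (Set.Finite.biUnion (antidiagonal d).finite_toSet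
    fun e _ => (hf e.1).prod (hg e.2)) fun p hp => ?_
  rw [Set.mem_ofPred_eq, MvPowerSeries.coeff_mul] at hp
  obtain ⟨e, he, hne⟩ := Finset.exists_ne_zero_of_sum_ne_zero hp
  simp only [Set.mem_iUnion]
  exact ⟨e, he, left_ne_zero_of_mul hne, right_ne_zero_of_mul hne⟩

/-- The decompositions of a pair of natural numbers. -/
abbrev pairAntidiagonal : Finset.HasAntidiagonal (ℕ × ℕ) where
  antidiagonal n := (antidiagonal n.1 ×ˢ antidiagonal n.2).map
    (Equiv.prodProdProdComm ℕ ℕ ℕ ℕ).toEmbedding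
  mem_antidiagonal := by
    rintro ⟨n, m⟩ ⟨⟨a, b⟩, ⟨c, d⟩⟩
    simp [Equiv.prodProdProdComm, Prod.ext_iff]

/-- The Cauchy product for families indexed by numbers of vertices and edges, both of which add up
under gluing. -/
theorem LocFin.hasSum_mul {f g : ℕ × ℕ → MvPowerSeries J ℂ} (hf : LocFin f) (hg : LocFin g) :
    HasSum (fun n : ℕ × ℕ => ∑ m ∈ antidiagonal n.1, ∑ r ∈ antidiagonal n.2,
      f (m.1, r.1) * g (m.2, r.2)) ((∑' n, f n) * ∑' n, g n) := by
  let _ := pairAntidiagonal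
  have h := hf.summable.tsum_mul_tsum_eq_tsum_sum_antidiagonal hg.summable (hf.mul hg).summable
  have h' := (summable_sum_mul_antidiagonal_of_summable_mul (hf.mul hg).summable).hasSum
  rw [← h] at h'
  refine h'.congr_fun fun n => ?_
  exact (Finset.sum_product' (antidiagonal n.1) (antidiagonal n.2)
    fun m r => f (m.1, r.1) * g (m.2, r.2)).symm.trans (Finset.sum_map
      (antidiagonal n.1 ×ˢ antidiagonal n.2) (Equiv.prodProdProdComm ℕ ℕ ℕ ℕ).toEmbedding
      fun p => f p.1 * g p.2).symm

end LocallyFinite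

/-! ### Finiteness at each order in the couplings -/

section Bound

variable {X : Type u} [Fintype X] {J : Type v} {ν : FieldAlg X →ₗ[ℂ] MvPowerSeries J ℂ}

theorem IsInteraction.exists_card_le (hν : IsInteraction ν) (d : J →₀ ℕ) :
    ∃ D : ℕ, ∀ {ι : Type} (s : Finset ι) (y : ι → X) (e : J →₀ ℕ), e ≤ d →
      MvPowerSeries.coeff e (ν (∏ i ∈ s, phi (y i))) ≠ 0 → s.card ≤ D := by
  classical
  choose D hD using hν.finite_order
  refine ⟨(Finset.Iic d).sup D, fun s y e he hne => ?_⟩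
  by_contra hlt
  have h1 : D e ≤ (Finset.Iic d).sup D := Finset.le_sup (Finset.mem_Iic.2 he)
  refine hne ?_
  have h2 := hD e s.card (by omega) fun i => y (s.equivFin.symm i)
  rwa [s.equivFin.symm.prod_comp fun i : s => phi (y i), Finset.prod_coe_sort s fun i => phi (y i)]
    at h2

/-- In a contribution to the monomial `d` each vertex uses up positive order, which bounds the
number of vertices by the degree. The order at a vertex divides `d`, which bounds its valence and
hence the number of edges. The bound depends on neither legs nor graph. -/
theorem IsInteraction.exists_size_bound (hν : IsInteraction ν) (G : Matrix X X ℂ) (d : J →₀ ℕ) :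
    ∃ N : ℕ, ∀ (P Q L : Type) [Fintype P] [Fintype Q] [Fintype L] [DecidableEq P] [DecidableEq Q]
      [DecidableEq L] (Γ : LGraph P Q L) (x : L → X),
      MvPowerSeries.coeff d (Γ.val G ν x) ≠ 0 → Fintype.card P ≤ N ∧ Fintype.card Q ≤ N := by
  classical
  obtain ⟨D, hD⟩ := hν.exists_card_le d
  refine ⟨d.degree * (D + 1), fun P Q L _ _ _ _ _ _ Γ x hne => ?_⟩
  rw [LGraph.val, map_sum] at hne
  obtain ⟨a, -, hne⟩ := Finset.exists_ne_zero_of_sum_ne_zero hne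
  rw [map_sum] at hne
  obtain ⟨b, -, hne⟩ := Finset.exists_ne_zero_of_sum_ne_zero hne
  rw [map_sum] at hne
  obtain ⟨c, -, hne⟩ := Finset.exists_ne_zero_of_sum_ne_zero hne
  rw [MvPowerSeries.coeff_smul] at hne
  replace hne := right_ne_zero_of_mul hne
  rw [MvPowerSeries.coeff_prod] at hne
  obtain ⟨l, hl, hne⟩ := Finset.exists_ne_zero_of_sum_ne_zero hne
  rw [Finset.mem_finsuppAntidiag] at hl
  replace hne (i : P) := Finset.prod_ne_zero_iff.1 hne i (Finset.mem_univ i)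
  have hle (i : P) : l i ≤ d := hl.1 ▸ Finset.single_le_sum (fun _ _ => zero_le) (Finset.mem_univ i)
  have hpos (i : P) : 1 ≤ (l i).degree := by
    rw [Nat.one_le_iff_ne_zero, Ne, Finsupp.degree_eq_zero_iff]
    intro h0
    refine hne i ?_
    rw [h0]
    exact hν.constantCoeff_eq_zero _
  have hP : Fintype.card P ≤ d.degree := by
    rw [← hl.1, map_sum]
    calc Fintype.card P = ∑ _i : P, 1 := by simp
      _ ≤ _ := Finset.sum_le_sum fun i _ => hpos i
  -- Counting sources alone suffices, as each edge has exactly one.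
  have hval (i : P) : (Finset.univ.filter fun j => Γ.src j = i).card ≤ D := by
    have h1 : Γ.vertexOp a b c i = ∏ k ∈ ((Finset.univ.filter fun j => Γ.src j = i).disjSum
        (Finset.univ.filter fun j => Γ.tgt j = i)).disjSum (Finset.univ.filter fun l => Γ.leg l = i),
        phi (Sum.elim (Sum.elim a b) c k) := by
      simp [LGraph.vertexOp, Finset.prod_disjSum]
    have h2 := hne i
    rw [h1] at h2
    have h3 := hD _ _ _ (hle i) h2
    simp only [Finset.card_disjSum] at h3
    omega
  have hQ : Fintype.card Q ≤ Fintype.card P * D := by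
    rw [← Finset.card_univ, Finset.card_eq_sum_card_fiberwise (f := Γ.src) (t := Finset.univ)
      fun _ _ => Finset.mem_coe.2 (Finset.mem_univ _)]
    exact (Finset.sum_le_card_nsmul _ _ _ fun i _ => hval i).trans (by simp)
  exact ⟨by nlinarith, by nlinarith⟩

end Bound

/-! ### Connected functions with a given number of bridges -/

section Total

open scoped MvPowerSeries.WithPiTopology

variable {X : Type u} [Fintype X] {J : Type v} {ν : FieldAlg X →ₗ[ℂ] MvPowerSeries J ℂ}
  {L L' : Type} [Fintype L'] [DecidableEq L'] [Fintype L] [DecidableEq L]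

/-- The sum, with symmetry factors, of the values of all connected graphs with set of legs `L` and
exactly `b` bridges. -/
def bridgeFn (L : Type) [Fintype L] [DecidableEq L] (G : Matrix X X ℂ)
    (ν : FieldAlg X →ₗ[ℂ] MvPowerSeries J ℂ) (b : ℕ) (x : L → X) : MvPowerSeries J ℂ :=
  ∑' n : ℕ × ℕ, LGraph.sizeSum L G ν b x n.1 n.2

theorem bridgeFn_congr (G : Matrix X X ℂ) (ν : FieldAlg X →ₗ[ℂ] MvPowerSeries J ℂ) (b : ℕ)
    (e : L ≃ L') (x : L' → X) : bridgeFn L' G ν b x = bridgeFn L G ν b (x ∘ e) :=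
  tsum_congr fun n => LGraph.sizeSum_congr G ν b e x n.1 n.2

theorem IsInteraction.exists_sizeSum_bound (hν : IsInteraction ν) (G : Matrix X X ℂ)
    (d : J →₀ ℕ) : ∃ N : ℕ, ∀ (L : Type) [Fintype L] [DecidableEq L] (x : L → X) (b p q : ℕ),
      MvPowerSeries.coeff d (LGraph.sizeSum L G ν b x p q) ≠ 0 → p ≤ N ∧ q ≤ N := by
  classical
  obtain ⟨N, hN⟩ := hν.exists_size_bound G d
  refine ⟨N, fun L _ _ x b p q hne => ?_⟩
  rw [LGraph.sizeSum, MvPowerSeries.coeff_smul] at hne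
  replace hne := right_ne_zero_of_mul hne
  rw [LGraph.bridgeSum, map_sum] at hne
  obtain ⟨Γ, -, hne⟩ := Finset.exists_ne_zero_of_sum_ne_zero hne
  simpa using hN _ _ _ Γ x hne

theorem IsInteraction.locFin_sizeSum (hν : IsInteraction ν) (G : Matrix X X ℂ) (b : ℕ)
    (x : L → X) : LocFin fun n : ℕ × ℕ => LGraph.sizeSum L G ν b x n.1 n.2 := by
  intro d
  obtain ⟨N, hN⟩ := hν.exists_sizeSum_bound G d
  refine ((Set.finite_Iic N).prod (Set.finite_Iic N)).subset fun n hn => ?_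
  exact hN L x b n.1 n.2 hn

/-- The recursion by size, summed over all sizes; it is the flow equation in components. -/
theorem bridgeFn_succ [DecidableEq X] {G : Matrix X X ℂ} (hG : G.IsSymm) (hG' : IsUnit G.det)
    (hν : IsInteraction ν) (b : ℕ) (x : L → X) :
    (b + 1) • bridgeFn L G ν (b + 1) x = (1 / 2 : ℂ) •
      ∑ I : Finset L, ∑ ab ∈ antidiagonal b, ∑ y, ∑ z, G⁻¹ y z •
        (bridgeFn (Option {l // l ∈ I}) G ν ab.1 (fun l => l.elim y fun l => x l) *
          bridgeFn (Option {l // l ∉ I}) G ν ab.2 (fun l => l.elim z fun l => x l)) := by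
  have h1 : HasSum (fun n : ℕ × ℕ => (b + 1) • LGraph.sizeSum L G ν (b + 1) x n.1 n.2)
      ((b + 1) • bridgeFn L G ν (b + 1) x) :=
    (hν.locFin_sizeSum G (b + 1) x).summable.hasSum.const_smul _
  -- A graph with a bridge has an edge, so the terms with `q = 0` vanish and the sum may be shifted.
  have hinj : Function.Injective fun n : ℕ × ℕ => (n.1, n.2 + 1) := by
    rintro ⟨p, q⟩ ⟨p', q'⟩ h
    simpa using h
  rw [← hinj.hasSum_iff] at h1
  · refine h1.unique ?_
    have h2 (I : Finset L) (ab : ℕ × ℕ) (y z : X) :=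
      ((hν.locFin_sizeSum G ab.1 (fun l : Option {l // l ∈ I} => l.elim y fun l => x l)).hasSum_mul
        (hν.locFin_sizeSum G ab.2
          (fun l : Option {l // l ∉ I} => l.elim z fun l => x l))).const_smul (G⁻¹ y z)
    have h3 := (hasSum_sum (s := (Finset.univ : Finset (Finset L))) fun I _ =>
      hasSum_sum (s := antidiagonal b) fun ab _ =>
      hasSum_sum (s := (Finset.univ : Finset X)) fun y _ =>
      hasSum_sum (s := (Finset.univ : Finset X)) fun z _ => h2 I ab y z).const_smul (1 / 2 : ℂ)
    refine HasSum.congr_fun h3 fun n => ?_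
    rw [Function.comp_apply, LGraph.sizeSum_succ hG hG']
    congr 1
    simp only [Finset.smul_sum]
    rw [← Finset.sum_product', Finset.sum_comm]
    refine Finset.sum_congr rfl fun I _ => ?_
    rw [Finset.sum_comm]
    refine Finset.sum_congr rfl fun ab _ => ?_
    rw [Finset.sum_comm]
    refine Finset.sum_congr rfl fun y _ => ?_
    rw [Finset.sum_comm]
    refine Finset.sum_congr rfl fun z _ => ?_
    exact Finset.sum_product _ _ _
  · rintro ⟨p, q⟩ hq
    have : q = 0 := by
      by_contra h
      exact hq ⟨(p, q - 1), by simp; omega⟩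
    subst this
    rw [LGraph.sizeSum_of_lt _ _ _ _ (Nat.succ_pos b), smul_zero]

/-- If the 1PI one-point function vanishes, graphs with at most one leg cancel. -/
theorem bridgeFn_eq_zero_of_card_le_one [DecidableEq X] {G : Matrix X X ℂ} (hG : G.IsSymm)
    (hG' : IsUnit G.det) (hν : IsInteraction ν)
    (h0 : ∀ (L : Type) [Fintype L] [DecidableEq L] (x : L → X), Fintype.card L = 1 →
      bridgeFn L G ν 0 x = 0) (b : ℕ) (x : L → X) (hL : Fintype.card L ≤ 1)
    (hb : b ≠ 0 ∨ Fintype.card L = 1) : bridgeFn L G ν b x = 0 := by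
  induction b using Nat.strong_induction_on generalizing L with
  | _ b ih =>
    obtain _ | b := b
    · exact h0 L x (by simpa using hb)
    have h1 := bridgeFn_succ hG hG' hν b x
    have h2 : (b + 1) • bridgeFn L G ν (b + 1) x = 0 := by
      rw [h1]
      refine smul_eq_zero_of_right _ (Finset.sum_eq_zero fun I _ => Finset.sum_eq_zero fun ab hab =>
        Finset.sum_eq_zero fun y _ => Finset.sum_eq_zero fun z _ => ?_)
      rw [Finset.HasAntidiagonal.mem_antidiagonal] at hab
      -- With at most one leg in all, one half gets none of the old legs and so has just the leg of
      -- the cut; it has at most `b` bridges, and its function vanishes by induction.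
      by_cases hI : I.card = 0
      · rw [ih ab.1 (by omega) _ (by simp [hI]) (Or.inr (by simp [hI])), zero_mul, smul_zero]
      · have hI' : I.card = Fintype.card L := by
          have := I.card_le_univ
          omega
        have hc : Fintype.card {l // l ∉ I} = 0 := by
          simp [Fintype.card_subtype_compl, hI']
        rw [ih ab.2 (by omega) _ (by simp [hc]) (Or.inr (by simp [hc])), mul_zero, smul_zero]
    rw [← Nat.cast_smul_eq_nsmul ℂ] at h2
    exact (smul_eq_zero.1 h2).resolve_left (Nat.cast_ne_zero.2 (Nat.succ_ne_zero b))

end Total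

/-! ### Relation to the functions defined by Feynman graphs -/

section Link

variable {X : Type u} [Fintype X] {J : Type v} {ν : FieldAlg X →ₗ[ℂ] MvPowerSeries J ℂ} {n : ℕ}

/-- A Feynman graph as a graph with numbered vertices and edges. -/
def graphEquiv (n : ℕ) : FeynmanGraph n ≃ Σ s : ℕ × ℕ, LGraph (Fin s.1) (Fin s.2) (Fin n) where
  toFun Γ := ⟨(Γ.p, Γ.q), ⟨Γ.src, Γ.tgt, Γ.leg⟩⟩
  invFun Γ := ⟨Γ.1.1, Γ.1.2, Γ.2.src, Γ.2.tgt, Γ.2.leg⟩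
  left_inv _ := rfl
  right_inv _ := rfl

theorem isConnected_iff (Γ : FeynmanGraph n) :
    Γ.IsConnected ↔ (graphEquiv n Γ).2.JoinedBy Set.univ :=
  connected_fromRel_iff _ _ _

theorem is1PI_iff (Γ : FeynmanGraph n) :
    Γ.Is1PI ↔ (graphEquiv n Γ).2.JoinedBy Set.univ ∧ (graphEquiv n Γ).2.bridgeCount = 0 := by
  rw [LGraph.bridgeCount_eq_zero, ← isConnected_iff]
  exact and_congr_right fun _ => forall_congr' fun j => connected_fromRel_iff _ _ _

theorem IsInteraction.finite_graphs (hν : IsInteraction ν) (G : Matrix X X ℂ) (x : Fin n → X)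
    (d : J →₀ ℕ) :
    {Γ : FeynmanGraph n | MvPowerSeries.coeff d (Γ.value G ν x) ≠ 0}.Finite := by
  obtain ⟨N, hN⟩ := hν.exists_size_bound G d
  have h : (⋃ s ∈ Finset.range (N + 1) ×ˢ Finset.range (N + 1), Set.range
      fun Γ : LGraph (Fin s.1) (Fin s.2) (Fin n) => (graphEquiv n).symm ⟨s, Γ⟩).Finite :=
    (Finset.finite_toSet _).biUnion fun s _ => Set.finite_range _
  refine h.subset fun Γ hΓ => ?_
  have hs := hN (Fin Γ.p) (Fin Γ.q) (Fin n) (graphEquiv n Γ).2 x hΓ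
  simp only [Fintype.card_fin] at hs
  simp only [Set.mem_iUnion]
  exact ⟨(Γ.p, Γ.q), by simpa [Nat.lt_succ_iff] using hs, (graphEquiv n Γ).2, rfl⟩

-- Regroups the sum over all numbered graphs by size; finite support justifies passing through
-- `tsum` to split the sum over the sigma type.
open Classical in
theorem coeff_graphSum (hν : IsInteraction ν) (G : Matrix X X ℂ) (P : FeynmanGraph n → Prop)
    (x : Fin n → X) (d : J →₀ ℕ) :
    MvPowerSeries.coeff d (graphSum G ν P x) = ∑ᶠ s : ℕ × ℕ, MvPowerSeries.coeff d
      ((1 / ((s.1.factorial : ℂ) * (s.2.factorial : ℂ) * 2 ^ s.2)) •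
        ∑ Γ : LGraph (Fin s.1) (Fin s.2) (Fin n) with P ((graphEquiv n).symm ⟨s, Γ⟩),
          Γ.val G ν x) := by
  obtain ⟨N, hN⟩ := hν.exists_size_bound G d
  let F (Γ : FeynmanGraph n) : ℂ :=
    if P Γ then Γ.weight * MvPowerSeries.coeff d (Γ.value G ν x) else 0
  have hF : (Function.support F).Finite := by
    refine (hν.finite_graphs G x d).subset fun Γ hΓ => ?_
    rw [Function.mem_support] at hΓ
    by_cases h : P Γ
    · simp only [F, h, if_true] at hΓ
      exact right_ne_zero_of_mul hΓ
    · simp [F, h] at hΓ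
  have hs (s : ℕ × ℕ) : MvPowerSeries.coeff d
      ((1 / ((s.1.factorial : ℂ) * (s.2.factorial : ℂ) * 2 ^ s.2)) •
        ∑ Γ : LGraph (Fin s.1) (Fin s.2) (Fin n) with P ((graphEquiv n).symm ⟨s, Γ⟩),
          Γ.val G ν x) =
      ∑ Γ : LGraph (Fin s.1) (Fin s.2) (Fin n), F ((graphEquiv n).symm ⟨s, Γ⟩) := by
    rw [MvPowerSeries.coeff_smul, map_sum, Finset.sum_filter, Finset.mul_sum]
    refine Finset.sum_congr rfl fun Γ _ => ?_
    rw [mul_ite, mul_zero]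
    rfl
  simp only [hs]
  change ∑ᶠ Γ, F Γ = _
  have hF' : Summable fun p : Σ s : ℕ × ℕ, LGraph (Fin s.1) (Fin s.2) (Fin n) =>
      F ((graphEquiv n).symm p) :=
    (graphEquiv n).symm.summable_iff.2 (summable_of_hasFiniteSupport hF)
  rw [← tsum_eq_finsum (L := .unconditional _) hF, ← (graphEquiv n).symm.tsum_eq,
    hF'.tsum_sigma' fun s => (hasSum_fintype _).summable, ← tsum_eq_finsum (L := .unconditional _)]
  · exact tsum_congr fun s => tsum_fintype _
  · refine ((Set.finite_Iic N).prod (Set.finite_Iic N)).subset fun s hs => ?_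
    obtain ⟨Γ, -, hΓ⟩ := Finset.exists_ne_zero_of_sum_ne_zero hs
    by_cases h : P ((graphEquiv n).symm ⟨s, Γ⟩)
    · simp only [F, h, if_true] at hΓ
      have := hN (Fin s.1) (Fin s.2) (Fin n) Γ x (right_ne_zero_of_mul hΓ)
      simp only [Fintype.card_fin] at this
      exact this
    · simp [F, h] at hΓ

open Classical in
theorem graphSum_bridge (hν : IsInteraction ν) (G : Matrix X X ℂ) (b : ℕ) (x : Fin n → X) :
    graphSum G ν (fun Γ => (graphEquiv n Γ).2.JoinedBy Set.univ ∧
      (graphEquiv n Γ).2.bridgeCount = b) x = bridgeFn (Fin n) G ν b x := by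
  ext d
  rw [bridgeFn, (hν.locFin_sizeSum G b x).coeff_tsum, coeff_graphSum hν]
  refine finsum_congr fun s => ?_
  simp only [LGraph.sizeSum, LGraph.bridgeSum]
  congr!

theorem onePIFn_eq (hν : IsInteraction ν) (G : Matrix X X ℂ) (x : Fin n → X) :
    onePIFn G ν n x = bridgeFn (Fin n) G ν 0 x := by
  rw [← graphSum_bridge hν, onePIFn]
  congr 1
  ext Γ
  exact is1PI_iff Γ

theorem finite_bridgeFn (hν : IsInteraction ν) (G : Matrix X X ℂ) (x : Fin n → X) (d : J →₀ ℕ) :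
    {b | MvPowerSeries.coeff d (bridgeFn (Fin n) G ν b x) ≠ 0}.Finite := by
  obtain ⟨N, hN⟩ := hν.exists_sizeSum_bound G d
  refine (Set.finite_Iic N).subset fun b hb => ?_
  rw [Set.mem_ofPred_eq, bridgeFn, (hν.locFin_sizeSum G b x).coeff_tsum] at hb
  obtain ⟨s, hs⟩ : ∃ s : ℕ × ℕ,
      MvPowerSeries.coeff d (LGraph.sizeSum (Fin n) G ν b x s.1 s.2) ≠ 0 := by
    by_contra! h
    exact hb (finsum_eq_zero_of_forall_eq_zero h)
  have h1 := hN _ _ _ _ _ hs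
  by_contra hlt
  rw [LGraph.sizeSum_of_lt _ _ _ _ (lt_of_le_of_lt h1.2 (not_le.1 hlt))] at hs
  exact hs (map_zero _)

/-- Sorts the connected graphs by number of bridges. Only finitely many sizes, hence bridge numbers,
matter at order `d`. -/
theorem coeff_connectedFn (hν : IsInteraction ν) (G : Matrix X X ℂ) (x : Fin n → X)
    (d : J →₀ ℕ) : MvPowerSeries.coeff d (connectedFn G ν n x) =
      ∑ᶠ b, MvPowerSeries.coeff d (bridgeFn (Fin n) G ν b x) := by
  classical
  obtain ⟨N, hN⟩ := hν.exists_sizeSum_bound G d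
  -- The cutoff `K` is kept free: a common one, `N`, serves to exchange the sums, while bounding the
  -- support needs one for arbitrary `s`.
  have h1 (s : ℕ × ℕ) (K : ℕ) (hK : s.2 ≤ K) :
      (1 / ((s.1.factorial : ℂ) * (s.2.factorial : ℂ) * 2 ^ s.2)) •
        ∑ Γ : LGraph (Fin s.1) (Fin s.2) (Fin n) with
          ((graphEquiv n).symm ⟨s, Γ⟩).IsConnected, Γ.val G ν x =
      ∑ b ∈ Finset.range (K + 1), LGraph.sizeSum (Fin n) G ν b x s.1 s.2 := by
    simp only [LGraph.sizeSum, ← Finset.smul_sum]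
    congr 1
    rw [← Finset.sum_fiberwise_of_maps_to (t := Finset.range (K + 1))
      (g := fun Γ : LGraph (Fin s.1) (Fin s.2) (Fin n) => Γ.bridgeCount)]
    · refine Finset.sum_congr rfl fun b _ => ?_
      rw [Finset.filter_filter, LGraph.bridgeSum]
      refine Finset.sum_congr (Finset.filter_congr fun Γ _ => ?_) fun _ _ => rfl
      rw [isConnected_iff, Equiv.apply_symm_apply]
    · intro Γ _
      have := Γ.bridgeCount_le
      rw [Fintype.card_fin] at this
      rw [Finset.mem_range]
      omega
  have h2 (b : ℕ) : MvPowerSeries.coeff d (bridgeFn (Fin n) G ν b x) =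
      ∑ s ∈ Finset.range (N + 1) ×ˢ Finset.range (N + 1),
        MvPowerSeries.coeff d (LGraph.sizeSum (Fin n) G ν b x s.1 s.2) := by
    rw [bridgeFn, (hν.locFin_sizeSum G b x).coeff_tsum]
    refine finsum_eq_sum_of_support_subset _ fun s hs => ?_
    have := hN _ _ _ _ _ hs
    simp only [Finset.coe_product, Finset.coe_range, Set.mem_prod, Set.mem_Iio]
    omega
  rw [finsum_eq_sum_of_support_subset (s := Finset.range (N + 1))]
  · simp only [h2]
    rw [Finset.sum_comm, connectedFn, coeff_graphSum hν,
      finsum_eq_sum_of_support_subset (s := Finset.range (N + 1) ×ˢ Finset.range (N + 1))]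
    · refine Finset.sum_congr rfl fun s hs => ?_
      rw [Finset.mem_product, Finset.mem_range, Finset.mem_range] at hs
      rw [h1 s N (by omega), map_sum]
    · intro s hs
      rw [Function.mem_support, h1 s s.2 le_rfl, map_sum] at hs
      obtain ⟨b, -, hb⟩ := Finset.exists_ne_zero_of_sum_ne_zero hs
      have := hN _ _ _ _ _ hb
      simp only [Finset.coe_product, Finset.coe_range, Set.mem_prod, Set.mem_Iio]
      omega
  · intro b hb
    rw [Function.mem_support, h2] at hb
    obtain ⟨s, -, hs⟩ := Finset.exists_ne_zero_of_sum_ne_zero hb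
    have h3 := hN _ _ _ _ _ hs
    rw [Finset.coe_range, Set.mem_Iio]
    by_contra hlt
    rw [LGraph.sizeSum_of_lt _ _ _ _ (by omega)] at hs
    exact hs (map_zero _)

end Link

/-! ### Linear maps on the field operator algebra -/

section FieldAlg

variable {X : Type u}

/-- The basis of monomials of the field operator algebra. -/
def monomialBasis (X : Type u) : Module.Basis (X →₀ ℕ) ℂ (FieldAlg X) :=
  (Finsupp.basisSingleOne (R := ℂ) (ι := X)).symmetricAlgebra

theorem prod_phi_eq_monomialBasis {ι : Type*} [Fintype ι] (x : ι → X) :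
    ∏ i, phi (x i) = monomialBasis X (∑ i, Finsupp.single (x i) 1) := by
  have h (a : X) : (SymmetricAlgebra.equivMvPolynomial
      (Finsupp.basisSingleOne (R := ℂ) (ι := X))).symm (MvPolynomial.X a) = phi a := by
    rw [SymmetricAlgebra.equivMvPolynomial_symm_X, Finsupp.coe_basisSingleOne]
    rfl
  change _ = (SymmetricAlgebra.equivMvPolynomial
    (Finsupp.basisSingleOne (R := ℂ) (ι := X))).symm (MvPolynomial.basisMonomials X ℂ _)
  rw [MvPolynomial.coe_basisMonomials]
  beta_reduce
  rw [MvPolynomial.monomial_sum_one, map_prod]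
  exact Finset.prod_congr rfl fun i _ => (h (x i)).symm

theorem exists_sum_single_eq (m : X →₀ ℕ) :
    ∃ (n : ℕ) (y : Fin n → X), ∑ i, Finsupp.single (y i) 1 = m := by
  classical
  induction m using Finsupp.induction_linear with
  | zero => exact ⟨0, Fin.elim0, by simp⟩
  | add f g hf hg =>
    obtain ⟨n, y, rfl⟩ := hf
    obtain ⟨n', y', rfl⟩ := hg
    exact ⟨n + n', Fin.append y y', by simp [Fin.sum_univ_add]⟩
  | single a k => exact ⟨k, fun _ => a, by simp⟩

/-- Each label occurs equally often in `x` and `y`; bijections between the fibres combine to one of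
the indices. -/
theorem exists_equiv_of_sum_single_eq {n n' : ℕ} {x : Fin n → X} {y : Fin n' → X}
    (h : ∑ i, Finsupp.single (x i) 1 = ∑ i, Finsupp.single (y i) (1 : ℕ)) :
    ∃ e : Fin n ≃ Fin n', y ∘ e = x := by
  classical
  have hc {k : ℕ} (z : Fin k → X) (a : X) :
      (∑ i, Finsupp.single (z i) (1 : ℕ)) a = Fintype.card {i // z i = a} := by
    rw [Finsupp.finsetSum_apply, Fintype.card_subtype, Finset.card_filter]
    exact Finset.sum_congr rfl fun i _ => Finsupp.single_apply
  have he (a : X) : Nonempty ({i // x i = a} ≃ {i // y i = a}) :=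
    Fintype.card_eq.1 (by rw [← hc, ← hc, h])
  refine ⟨(Equiv.sigmaFiberEquiv x).symm.trans ((Equiv.sigmaCongrRight fun a => (he a).some).trans
    (Equiv.sigmaFiberEquiv y)), funext fun i => ?_⟩
  exact ((he (x i)).some ⟨i, rfl⟩).2

/-- A family of `n`-point functions that does not depend on the numbering of the points defines
a linear map. -/
theorem exists_linearMap_of_symm {M : Type*} [AddCommGroup M] [Module ℂ M]
    (F : (n : ℕ) → (Fin n → X) → M)
    (hF : ∀ n n' (e : Fin n ≃ Fin n') (y : Fin n' → X), F n (y ∘ e) = F n' y) :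
    ∃ ρ : FieldAlg X →ₗ[ℂ] M, ∀ n (x : Fin n → X), ρ (∏ i, phi (x i)) = F n x := by
  choose n y hy using exists_sum_single_eq (X := X)
  refine ⟨(monomialBasis X).constr ℂ fun m => F (n m) (y m), fun k x => ?_⟩
  rw [prod_phi_eq_monomialBasis, Module.Basis.constr_basis]
  obtain ⟨e, he⟩ := exists_equiv_of_sum_single_eq (hy (∑ i, Finsupp.single (x i) 1)).symm
  rw [← hF k _ e, he]

theorem fieldAlg_induction {motive : FieldAlg X → Prop}
    (prod : ∀ n (x : Fin n → X), motive (∏ i, phi (x i)))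
    (add : ∀ a b, motive a → motive b → motive (a + b))
    (smul : ∀ (c : ℂ) a, motive a → motive (c • a)) (a : FieldAlg X) : motive a := by
  have hz : motive 0 := by simpa using smul 0 _ (prod 0 Fin.elim0)
  have h := (monomialBasis X).mem_span a
  induction h using Submodule.span_induction with
  | mem a ha =>
    obtain ⟨m, rfl⟩ := ha
    obtain ⟨n, y, rfl⟩ := exists_sum_single_eq m
    rw [← prod_phi_eq_monomialBasis]
    exact prod n y
  | zero => exact hz
  | add a b _ _ ha hb => exact add a b ha hb
  | smul c a _ ha => exact smul c a ha

theorem coproduct_phi (x : X) :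
    coproduct X (phi x) = phi x ⊗ₜ[ℂ] 1 + 1 ⊗ₜ[ℂ] phi x := by
  rw [coproduct, phi, SymmetricAlgebra.lift_ι_apply]
  rfl

theorem coproduct_prod_phi {L : Type*} [Fintype L] [DecidableEq L] (x : L → X) :
    coproduct X (∏ l, phi (x l)) = ∑ I : Finset L,
      (∏ l : {l // l ∈ I}, phi (x l)) ⊗ₜ[ℂ] ∏ l : {l // l ∉ I}, phi (x l) := by
  simp only [map_prod, coproduct_phi]
  rw [Finset.prod_add, Finset.powerset_univ]
  refine Finset.sum_congr rfl fun I _ => ?_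
  have h1 : ∏ l ∈ I, phi (x l) ⊗ₜ[ℂ] (1 : FieldAlg X) = (∏ l ∈ I, phi (x l)) ⊗ₜ 1 :=
    (map_prod (Algebra.TensorProduct.includeLeft (R := ℂ) (S := ℂ) (A := FieldAlg X)
      (B := FieldAlg X)) (fun l => phi (x l)) I).symm
  have h2 : ∏ l ∈ Finset.univ \ I, (1 : FieldAlg X) ⊗ₜ[ℂ] phi (x l) =
      1 ⊗ₜ (∏ l ∈ Finset.univ \ I, phi (x l)) :=
    (map_prod (Algebra.TensorProduct.includeRight (R := ℂ) (A := FieldAlg X)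
      (B := FieldAlg X)) (fun l => phi (x l)) _).symm
  rw [h1, h2, Algebra.TensorProduct.tmul_mul_tmul, one_mul, mul_one,
    Finset.prod_coe_sort I fun l => phi (x l),
    Finset.prod_subtype (Finset.univ \ I) (p := (· ∉ I)) (by simp) fun l => phi (x l)]

end FieldAlg

/-! ### The flow of the quadratic map given by `Q` -/

section Flow

variable {X : Type u} [Fintype X] [DecidableEq X] {B : Type v} [CommRing B] [Algebra ℂ B]

/-- The product of two copies of a linear functional, composed with `Q`. -/
def quadStep (G : Matrix X X ℂ) (S : FieldAlg X →ₗ[ℂ] B) : FieldAlg X →ₗ[ℂ] B :=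
  LinearMap.mul' ℂ B ∘ₗ TensorProduct.map S S ∘ₗ Q G

/-- Brings `Q` into the shape of `bridgeFn_succ`: the coproduct distributes the legs and `R` adds
one leg, the `none` of `Option`, to each half. -/
theorem quadStep_prod_phi {L : Type*} [Fintype L] [DecidableEq L] (G : Matrix X X ℂ)
    (S : FieldAlg X →ₗ[ℂ] B) (x : L → X) :
    quadStep G S (∏ l, phi (x l)) = (1 / 2 : ℂ) • ∑ I : Finset L, ∑ y, ∑ z, G⁻¹ y z •
      (S (∏ l : Option {l // l ∈ I}, phi (l.elim y fun l => x l)) *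
        S (∏ l : Option {l // l ∉ I}, phi (l.elim z fun l => x l))) := by
  simp only [quadStep, Q, LinearMap.comp_apply, LinearMap.smul_apply, LinearMap.mulLeft_apply,
    AlgHom.toLinearMap_apply, coproduct_prod_phi, R, Finset.sum_mul, map_smul,
    map_sum, smul_mul_assoc, Algebra.TensorProduct.tmul_mul_tmul, TensorProduct.map_tmul,
    LinearMap.mul'_apply, Fintype.prod_option, Option.elim_none, Option.elim_some]

theorem tprod_eq_prod_single {k : ℕ} (a : Fin k → FieldAlg X) :
    PiTensorProduct.tprod ℂ a = ∏ i, single i (a i) := by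
  have h := Finset.univ_prod_mulSingle a
  conv_lhs => rw [← h]
  rw [PiTensorProduct.tprod_prod]
  rfl

theorem tensorFunctional_prod_single {k : ℕ} (S : FieldAlg X →ₗ[ℂ] B) (a : Fin k → FieldAlg X) :
    tensorFunctional S k (∏ i, single i (a i)) = ∏ i, S (a i) := by
  rw [← tprod_eq_prod_single, tensorFunctional, PiTensorProduct.lift.tprod]
  simp

theorem Qi_prod_single (G : Matrix X X ℂ) {k : ℕ} (i : Fin k) (a : Fin k → FieldAlg X) :
    Qi G i (∏ j, single j (a j)) =
      (Algebra.TensorProduct.productMap (single i.castSucc) (single i.succ)) (Q G (a i)) *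
        ∏ j ∈ Finset.univ.erase i, single (i.succ.succAbove j) (a j) := by
  rw [← tprod_eq_prod_single, Qi, PiTensorProduct.lift.tprod]
  simp only [MultilinearMap.compLinearMap_apply, MultilinearMap.mkPiAlgebra_apply]
  rw [← Finset.mul_prod_erase _ _ (Finset.mem_univ i)]
  congr 1
  · simp
  · refine Finset.prod_congr rfl fun j hj => ?_
    have hne : j ≠ i := Finset.ne_of_mem_erase hj
    rcases lt_or_gt_of_ne hne with h | h
    · rw [if_pos h, Fin.succAbove_of_castSucc_lt _ _ (by simpa using h.le)]
      rfl
    · rw [if_neg h.not_gt, if_neg hne, Fin.succAbove_of_le_castSucc _ _ (by simpa using h)]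
      rfl

theorem tensorFunctional_Qi (G : Matrix X X ℂ) {k : ℕ} (S : FieldAlg X →ₗ[ℂ] B) (i : Fin k)
    (a : Fin k → FieldAlg X) :
    tensorFunctional S (k + 1) (Qi G i (∏ j, single j (a j))) =
      quadStep G S (a i) * ∏ j ∈ Finset.univ.erase i, S (a j) := by
  rw [Qi_prod_single, quadStep, LinearMap.comp_apply, LinearMap.comp_apply]
  induction Q G (a i) using TensorProduct.induction_on with
  | zero => simp
  | add s t hs ht => rw [map_add, add_mul, map_add, hs, ht, map_add, map_add, add_mul]
  | tmul s t =>
    -- The tensor with `s` and `t` at the adjacent positions `i.castSucc` and `i.succ`, and the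
    -- other factors of `a` in order around them.
    have h := tensorFunctional_prod_single S
      (i.succ.insertNth t (Function.update a i s) : Fin (k + 1) → FieldAlg X)
    rw [Fin.prod_univ_succAbove _ i.succ, Fin.prod_univ_succAbove _ i.succ] at h
    simp only [Fin.insertNth_apply_same, Fin.insertNth_apply_succAbove] at h
    rw [← Finset.mul_prod_erase _ _ (Finset.mem_univ i),
      ← Finset.mul_prod_erase _ (fun j => S (Function.update a i s j)) (Finset.mem_univ i)] at h
    have e1 : ∏ j ∈ Finset.univ.erase i,
        single (i.succ.succAbove j) (Function.update a i s j) =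
        ∏ j ∈ Finset.univ.erase i, single (i.succ.succAbove j) (a j) :=
      Finset.prod_congr rfl fun j hj => by rw [Function.update_of_ne (Finset.ne_of_mem_erase hj)]
    have e2 : ∏ j ∈ Finset.univ.erase i, S (Function.update a i s j) =
        ∏ j ∈ Finset.univ.erase i, S (a j) :=
      Finset.prod_congr rfl fun j hj => by rw [Function.update_of_ne (Finset.ne_of_mem_erase hj)]
    rw [e1, e2, Function.update_self,
      Fin.succAbove_of_castSucc_lt i.succ i i.castSucc_lt_succ] at h
    rw [Algebra.TensorProduct.productMap_apply_tmul, TensorProduct.map_tmul, LinearMap.mul'_apply,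
      mul_comm (single i.castSucc s), mul_assoc, h]
    ring

end Flow

theorem derivation_prod {K B ι : Type*} [CommRing K] [CommRing B] [Algebra K B] [DecidableEq ι]
    (D : Derivation K B B) (s : Finset ι) (f : ι → B) :
    D (∏ i ∈ s, f i) = ∑ i ∈ s, D (f i) * ∏ j ∈ s.erase i, f j := by
  induction s using Finset.induction_on with
  | empty => simp
  | insert a s ha ih =>
    rw [Finset.prod_insert ha, D.leibniz, ih, Finset.sum_insert ha, Finset.erase_insert ha,
      smul_eq_mul, smul_eq_mul, Finset.mul_sum, add_comm, mul_comm (∏ i ∈ s, f i)]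
    congr 1
    refine Finset.sum_congr rfl fun i hi => ?_
    have hne : a ≠ i := fun h => ha (h ▸ hi)
    rw [Finset.erase_insert_of_ne hne, Finset.prod_insert fun h => ha (Finset.mem_of_mem_erase h)]
    ring

/-! ### Taylor coefficients of a solution of the flow -/

section Flow

variable {X : Type u} [Fintype X] [DecidableEq X] {A : Type v} [CommRing A] [Algebra ℂ A]
  {G : Matrix X X ℂ} {S : FieldAlg X →ₗ[ℂ] PowerSeries A}

theorem derivative_smul_complex (r : ℂ) (f : PowerSeries A) :
    PowerSeries.derivative A (r • f) = r • PowerSeries.derivative A f := by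
  rw [← algebraMap_smul A r f, Derivation.map_smul, algebraMap_smul]

theorem coeff_smul_complex (r : ℂ) (n : ℕ) (f : PowerSeries A) :
    PowerSeries.coeff n (r • f) = r • PowerSeries.coeff n f := by
  rw [← algebraMap_smul A r f, map_smul, algebraMap_smul]

theorem constantCoeff_smul_complex (r : ℂ) (f : PowerSeries A) :
    PowerSeries.constantCoeff (r • f) = r • PowerSeries.constantCoeff f := by
  rw [← PowerSeries.coeff_zero_eq_constantCoeff_apply, coeff_smul_complex,
    PowerSeries.coeff_zero_eq_constantCoeff_apply]

/-- The Leibniz rule: differentiating the `i`-th factor `S` amounts to applying `Q` there. -/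
theorem derivative_tensorFunctional
    (hS : ∀ a, PowerSeries.derivative A (S a) = quadStep G S a) {k : ℕ} (z : TPow X k) :
    PowerSeries.derivative A (tensorFunctional S k z) =
      ∑ i, tensorFunctional S (k + 1) (Qi G i z) := by
  induction z using PiTensorProduct.induction_on with
  | smul_tprod r a =>
    simp only [map_smul, ← Finset.smul_sum]
    rw [derivative_smul_complex, tprod_eq_prod_single, tensorFunctional_prod_single,
      derivation_prod]
    simp only [hS, tensorFunctional_Qi]
  | add z w hz hw => simp only [map_add, hz, hw, Finset.sum_add_distrib]

theorem iterate_derivative_eq (hS : ∀ a, PowerSeries.derivative A (S a) = quadStep G S a) (m : ℕ)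
    (a : FieldAlg X) : (PowerSeries.derivative A)^[m] (S a) =
      (m.factorial : ℂ) • sigmaComponent G S m a := by
  induction m with
  | zero =>
    have h := tensorFunctional_prod_single S fun _ : Fin 1 => a
    simp only [Finset.univ_unique, Finset.prod_singleton] at h
    simpa [sigmaComponent, Lambda] using h.symm
  | succ m ih =>
    rw [Function.iterate_succ_apply', ih, derivative_smul_complex, sigmaComponent,
      LinearMap.comp_apply, derivative_tensorFunctional hS, sigmaComponent, LinearMap.comp_apply,
      Lambda, LinearMap.smul_apply, map_smul, LinearMap.sum_apply, map_sum, smul_smul,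
      Nat.factorial_succ]
    congr 1
    have : ((m + 1 : ℕ) : ℂ) ≠ 0 := Nat.cast_ne_zero.2 (Nat.succ_ne_zero m)
    push_cast at this ⊢
    field_simp

/-- A solution of the flow of `Q` has the Taylor coefficients `τ^{⊗ (m+1)} ∘ Λ^m`. -/
theorem sigmaComponent_eq_coeff (hS : ∀ a, PowerSeries.derivative A (S a) = quadStep G S a)
    {τ : FieldAlg X →ₗ[ℂ] A} (hτ : ∀ a, PowerSeries.constantCoeff (S a) = τ a) (m : ℕ)
    (a : FieldAlg X) : sigmaComponent G τ m a = PowerSeries.coeff m (S a) := by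
  have h1 (k : ℕ) (z : TPow X k) :
      PowerSeries.constantCoeff (tensorFunctional S k z) = tensorFunctional τ k z := by
    induction z using PiTensorProduct.induction_on with
    | smul_tprod r a =>
      rw [map_smul, constantCoeff_smul_complex, map_smul, tprod_eq_prod_single,
        tensorFunctional_prod_single, tensorFunctional_prod_single, map_prod]
      simp only [hτ]
    | add z w hz hw => simp only [map_add, hz, hw]
  have h2 := congrArg (PowerSeries.coeff 0) (iterate_derivative_eq hS m a)
  rw [coeff_smul_complex, PowerSeries.coeff_zero_eq_constantCoeff_apply,
    PowerSeries.coeff_zero_eq_constantCoeff_apply, PowerSeries.constantCoeff_iterate_derivative,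
    sigmaComponent, LinearMap.comp_apply, h1] at h2
  have h3 : ((m.factorial : ℕ) : ℂ) ≠ 0 := Nat.cast_ne_zero.2 m.factorial_ne_zero
  rw [← map_natCast (algebraMap ℂ A), ← Algebra.smul_def] at h2
  exact (smul_right_injective A h3 h2).symm

end Flow

/-! ### Connected functions in terms of 1PI functions -/

section Main

variable {X : Type u} [Fintype X] [DecidableEq X] {J : Type v} {G : Matrix X X ℂ}
  {ν : FieldAlg X →ₗ[ℂ] MvPowerSeries J ℂ}

/-- The generating series of the connected functions by number of bridges, without the graphs
that have neither legs nor bridges. -/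
def bridgeSeries (G : Matrix X X ℂ) (ν : FieldAlg X →ₗ[ℂ] MvPowerSeries J ℂ) (n : ℕ)
    (x : Fin n → X) : PowerSeries (MvPowerSeries J ℂ) :=
  PowerSeries.mk fun b => if n = 0 ∧ b = 0 then 0 else bridgeFn (Fin n) G ν b x

theorem bridgeSeries_congr {n n' : ℕ} (e : Fin n ≃ Fin n') (y : Fin n' → X) :
    bridgeSeries G ν n (y ∘ e) = bridgeSeries G ν n' y := by
  have hn : n = n' := by simpa using Fintype.card_congr e
  subst hn
  ext1 b
  rw [bridgeSeries, bridgeSeries, PowerSeries.coeff_mk, PowerSeries.coeff_mk,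
    bridgeFn_congr G ν b e y]

theorem coeff_bridge_of_card {S : FieldAlg X →ₗ[ℂ] PowerSeries (MvPowerSeries J ℂ)}
    (hS : ∀ n (x : Fin n → X), S (∏ i, phi (x i)) = bridgeSeries G ν n x)
    {L : Type} [Fintype L] [DecidableEq L] (x : L → X) (b : ℕ)
    (h : Fintype.card L ≠ 0 ∨ b ≠ 0) :
    PowerSeries.coeff b (S (∏ l, phi (x l))) = bridgeFn L G ν b x := by
  rw [← (Fintype.equivFin L).symm.prod_comp fun l => phi (x l)]
  rw [hS _ fun i => x ((Fintype.equivFin L).symm i), bridgeSeries, PowerSeries.coeff_mk,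
    if_neg (by tauto), bridgeFn_congr G ν b (Fintype.equivFin L).symm x]
  rfl

/-- The formal variable counts bridges, so `derivative` produces the factor `b + 1` of marking one.
The coefficient suppressed in `bridgeSeries` never enters: the left side has a bridge and each
factor on the right a leg. -/
theorem derivative_bridgeSeries (hG : G.IsSymm) (hG' : IsUnit G.det) (hν : IsInteraction ν)
    {S : FieldAlg X →ₗ[ℂ] PowerSeries (MvPowerSeries J ℂ)}
    (hS : ∀ n (x : Fin n → X), S (∏ i, phi (x i)) = bridgeSeries G ν n x) (a : FieldAlg X) :
    PowerSeries.derivative _ (S a) = quadStep G S a := by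
  induction a using fieldAlg_induction with
  | prod n x =>
    ext1 b
    rw [quadStep_prod_phi, PowerSeries.coeff_derivative, coeff_smul_complex,
      coeff_bridge_of_card hS x (b + 1) (Or.inr (Nat.succ_ne_zero b)), mul_comm]
    have h := bridgeFn_succ hG hG' hν b x
    rw [nsmul_eq_mul] at h
    push_cast at h
    rw [h]
    congr 1
    simp only [map_sum, coeff_smul_complex, PowerSeries.coeff_mul]
    refine Finset.sum_congr rfl fun I _ => ?_
    rw [Finset.sum_comm]
    refine Finset.sum_congr rfl fun y _ => ?_
    rw [Finset.sum_comm]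
    refine Finset.sum_congr rfl fun z _ => ?_
    rw [Finset.smul_sum]
    refine Finset.sum_congr rfl fun ab _ => ?_
    rw [coeff_bridge_of_card hS _ _ (Or.inl (by simp)), coeff_bridge_of_card hS _ _ (Or.inl (by simp))]
  | add a b ha hb => rw [map_add, map_add, map_add, ha, hb]
  | smul c a ha => rw [map_smul, derivative_smul_complex, map_smul, ha]

theorem exists_isNPointMap {F : (n : ℕ) → (Fin n → X) → MvPowerSeries J ℂ}
    (hF : ∀ n n' (e : Fin n ≃ Fin n') (y : Fin n' → X), F n (y ∘ e) = F n' y) :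
    ∃ ρ, IsNPointMap F ρ := by
  obtain ⟨ρ, hρ⟩ := exists_linearMap_of_symm (fun n x => if n = 0 then 0 else F n x)
    fun n n' e y => by
      have hn : n = n' := by simpa using Fintype.card_congr e
      rw [hF, hn]
  refine ⟨ρ, ?_, fun n hn x => ?_⟩
  · simpa using hρ 0 Fin.elim0
  · rw [hρ, if_neg (by omega)]

theorem onePIFn_comp (hν : IsInteraction ν) {n n' : ℕ} (e : Fin n ≃ Fin n') (y : Fin n' → X) :
    onePIFn G ν n (y ∘ e) = onePIFn G ν n' y := by
  rw [onePIFn_eq hν, onePIFn_eq hν, bridgeFn_congr G ν 0 e]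

theorem connectedFn_comp (hν : IsInteraction ν) {n n' : ℕ} (e : Fin n ≃ Fin n') (y : Fin n' → X) :
    connectedFn G ν n (y ∘ e) = connectedFn G ν n' y := by
  ext d
  rw [coeff_connectedFn hν, coeff_connectedFn hν]
  exact finsum_congr fun b => by rw [bridgeFn_congr G ν b e y]

/-- Identifies the summands of the main formula: `τ^{⊗(k+1)} ∘ Λ^k` collects the connected graphs
with `k` bridges, that is, with `k + 1` 1PI parts. -/
theorem sigmaComponent_prod_phi (hG : G.IsSymm) (hG' : IsUnit G.det) (hν : IsInteraction ν)
    {τ : FieldAlg X →ₗ[ℂ] MvPowerSeries J ℂ} (hτ : IsNPointMap (onePIFn G ν) τ) (k n : ℕ)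
    (x : Fin n → X) : sigmaComponent G τ k (∏ i, phi (x i)) =
      if n = 0 ∧ k = 0 then 0 else bridgeFn (Fin n) G ν k x := by
  obtain ⟨S, hS⟩ := exists_linearMap_of_symm (bridgeSeries G ν) fun _ _ e y => bridgeSeries_congr e y
  have h0 (a : FieldAlg X) : PowerSeries.constantCoeff (S a) = τ a := by
    induction a using fieldAlg_induction with
    | prod n x =>
      rw [hS, ← PowerSeries.coeff_zero_eq_constantCoeff_apply, bridgeSeries, PowerSeries.coeff_mk]
      obtain _ | n := n
      · simpa using hτ.1.symm
      · rw [hτ.2 _ (by omega), onePIFn_eq hν, if_neg (by simp)]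
    | add a b ha hb => rw [map_add, map_add, map_add, ha, hb]
    | smul c a ha => rw [map_smul, constantCoeff_smul_complex, map_smul, ha]
  rw [sigmaComponent_eq_coeff (derivative_bridgeSeries hG hG' hν hS) h0, hS, bridgeSeries,
    PowerSeries.coeff_mk]

/-- The vanishing of the 1PI one-point function enters here, to reconcile the components at zero
legs with `σ 1 = 0`. -/
theorem bridgeFn_zero_legs (hG : G.IsSymm) (hG' : IsUnit G.det) (hν : IsInteraction ν)
    (h1 : ∀ x : Fin 1 → X, onePIFn G ν 1 x = 0) (x : Fin 0 → X) {k : ℕ} (hk : k ≠ 0) :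
    bridgeFn (Fin 0) G ν k x = 0 := by
  refine bridgeFn_eq_zero_of_card_le_one hG hG' hν ?_ k x (by simp) (Or.inl hk)
  intro L _ _ x hL
  rw [bridgeFn_congr G ν 0 (Fintype.equivFinOfCardEq hL).symm, ← onePIFn_eq hν, h1]

theorem connected_eq_sum_sigmaComponent (hG : G.IsSymm) (hG' : IsUnit G.det)
    (hν : IsInteraction ν) (h1 : ∀ x : Fin 1 → X, onePIFn G ν 1 x = 0)
    {σ τ : FieldAlg X →ₗ[ℂ] MvPowerSeries J ℂ} (hσ : IsNPointMap (connectedFn G ν) σ)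
    (hτ : IsNPointMap (onePIFn G ν) τ) (a : FieldAlg X) (d : J →₀ ℕ) :
    {k : ℕ | MvPowerSeries.coeff d (sigmaComponent G τ k a) ≠ 0}.Finite ∧
      MvPowerSeries.coeff d (σ a) = ∑ᶠ k : ℕ, MvPowerSeries.coeff d (sigmaComponent G τ k a) := by
  induction a using fieldAlg_induction with
  | prod n x =>
    simp only [sigmaComponent_prod_phi hG hG' hν hτ]
    obtain _ | n := n
    · have h (k : ℕ) : (if k = 0 then 0 else bridgeFn (Fin 0) G ν k x) = 0 := by
        by_cases hk : k = 0
        · simp [hk]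
        · rw [bridgeFn_zero_legs hG hG' hν h1 x hk, ite_self]
      simp [h, hσ.1]
    · simp only [Nat.succ_ne_zero, false_and, if_false]
      refine ⟨finite_bridgeFn hν G x d, ?_⟩
      rw [hσ.2 _ (by omega), coeff_connectedFn hν]
  | add a b ha hb =>
    simp only [map_add]
    refine ⟨(ha.1.union hb.1).subset fun k hk => ?_, ?_⟩
    · by_contra h
      simp only [Set.mem_union, Set.mem_ofPred_eq, not_or, not_not] at h
      exact hk (by rw [h.1, h.2, add_zero])
    · rw [finsum_add_distrib ha.1 hb.1, ha.2, hb.2]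
  | smul c a ha =>
    simp only [map_smul]
    refine ⟨ha.1.subset fun k hk => right_ne_zero_of_mul hk, ?_⟩
    rw [ha.2, smul_finsum]

end Main

/-! ### Splitting a vertex -/

instance TPow.isScalarTower (X : Type u) (k : ℕ) : IsScalarTower ℂ (TPow X k) (TPow X k) :=
  IsScalarTower.right (R := ℂ) (A := TPow X k)

instance TPow.smulCommClass (X : Type u) (k : ℕ) : SMulCommClass ℂ (TPow X k) (TPow X k) :=
  Algebra.to_smulCommClass (R := ℂ) (A := TPow X k)

section Split

variable {X : Type u} [Fintype X] [DecidableEq X] {k : ℕ}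

theorem succ_succAbove_eq {i j : Fin k} (h : j ≠ i) :
    i.succ.succAbove j = i.castSucc.succAbove j := by
  rcases lt_or_gt_of_ne h with h | h
  · rw [Fin.succAbove_of_castSucc_lt _ _ (by simpa using h.le),
      Fin.succAbove_of_castSucc_lt _ _ (by simpa using h)]
  · rw [Fin.succAbove_of_le_castSucc _ _ (by simpa using h),
      Fin.succAbove_of_le_castSucc _ _ (by simpa using h.le)]

/-- The coproduct of the `i`-th factor, the other factors keeping their order. -/
def splitFactor (X : Type u) (i j : Fin k) : FieldAlg X →ₐ[ℂ] TPow X (k + 1) :=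
  if j = i then
    (Algebra.TensorProduct.productMap (single i.castSucc) (single i.succ)).comp (coproduct X)
  else single (i.castSucc.succAbove j)

/-- `Δ` applied to the `i`-th tensor factor. -/
def split (X : Type u) (i : Fin k) : TPow X k →ₐ[ℂ] TPow X (k + 1) :=
  PiTensorProduct.liftAlgHom
    ((MultilinearMap.mkPiAlgebra ℂ (Fin k) (TPow X (k + 1))).compLinearMap fun j =>
      (splitFactor X i j).toLinearMap)
    (by simp) (fun a b => by simp [Finset.prod_mul_distrib])

theorem split_prod_single (i : Fin k) (a : Fin k → FieldAlg X) :
    split X i (∏ j, single j (a j)) = ∏ j, splitFactor X i j (a j) := by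
  rw [← tprod_eq_prod_single]
  exact (PiTensorProduct.lift.tprod _).trans (by simp)

theorem split_single (i j : Fin k) (a : FieldAlg X) :
    split X i (single j a) = splitFactor X i j a := by
  have h := split_prod_single i (Pi.mulSingle j a)
  have h1 : ∏ m, single m ((Pi.mulSingle j a : Fin k → FieldAlg X) m) = single j a := by
    rw [Finset.prod_eq_single j]
    · rw [Pi.mulSingle_eq_same]
    · intro m _ hm
      rw [Pi.mulSingle_eq_of_ne hm, map_one]
    · simp
  rw [h1] at h
  rw [h, Finset.prod_eq_single j]
  · rw [Pi.mulSingle_eq_same]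
  · intro m _ hm
    rw [Pi.mulSingle_eq_of_ne hm, map_one]
  · simp

/-- `i.predAbove` merges the positions `i` and `i + 1`, so splitting sums over the preimages of `j`.
In this form the vertex that is split needs no separate treatment. -/
theorem split_single_phi (i j : Fin k) (x : X) :
    split X i (single j (phi x)) =
      ∑ m : Fin (k + 1), if i.predAbove m = j then single m (phi x) else 0 := by
  rw [split_single, Fin.sum_univ_succAbove _ i.castSucc]
  simp only [Fin.predAbove_succAbove, Fin.predAbove_castSucc_self, Finset.sum_ite_eq',
    Finset.mem_univ, if_true]
  by_cases h : j = i
  · subst h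
    simp [splitFactor, coproduct_phi, Fin.succAbove_castSucc_self]
  · rw [splitFactor, if_neg h, if_neg (Ne.symm h), zero_add]

theorem split_Rij (G : Matrix X X ℂ) (i a b : Fin k) :
    split X i (Rij G a b) = ∑ p : Fin (k + 1) × Fin (k + 1),
      if Prod.map i.predAbove i.predAbove p = (a, b) then Rij G p.1 p.2 else 0 := by
  have h (p : Fin (k + 1) × Fin (k + 1)) :
      (if Prod.map i.predAbove i.predAbove p = (a, b) then Rij G p.1 p.2 else 0) =
      ∑ x, ∑ y, G⁻¹ x y • ((if i.predAbove p.1 = a then single p.1 (phi x) else 0) *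
        if i.predAbove p.2 = b then single p.2 (phi y) else 0) := by
    by_cases h1 : i.predAbove p.1 = a <;> by_cases h2 : i.predAbove p.2 = b <;>
      simp [Prod.map, h1, h2, Rij]
  simp only [h]
  rw [Finset.sum_comm]
  simp only [Rij, map_sum, map_smul, map_mul, split_single_phi]
  refine Finset.sum_congr rfl fun x _ => ?_
  rw [Finset.sum_comm]
  refine Finset.sum_congr rfl fun y _ => ?_
  rw [← Finset.smul_sum, Finset.sum_mul_sum, Fintype.sum_prod_type]

/-- Unlike `Qi`, the map `split` is multiplicative, so it can be computed edge by edge and leg by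
leg. -/
theorem Qi_eq (G : Matrix X X ℂ) (i : Fin k) (z : TPow X k) :
    Qi G i z = (1 / 2 : ℂ) • (Rij G i.castSucc i.succ * split X i z) := by
  induction z using PiTensorProduct.induction_on with
  | smul_tprod r a =>
    rw [map_smul, map_smul, tprod_eq_prod_single, Qi_prod_single, split_prod_single,
      mul_smul_comm, smul_comm (1 / 2 : ℂ)]
    congr 1
    rw [← Finset.mul_prod_erase _ _ (Finset.mem_univ i), ← mul_assoc, ← smul_mul_assoc]
    congr 1
    · have h : Rij G i.castSucc i.succ = Algebra.TensorProduct.productMap (single i.castSucc)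
          (single i.succ) (R G) := by
        simp [Rij, R]
      rw [h, splitFactor, if_pos rfl, AlgHom.comp_apply, ← map_mul, ← map_smul]
      rfl
    · refine Finset.prod_congr rfl fun j hj => ?_
      have hne := Finset.ne_of_mem_erase hj
      rw [splitFactor, if_neg hne, succ_succAbove_eq hne]
  | add z w hz hw => rw [map_add, map_add, hz, hw, mul_add, smul_add]

/-- The product of the elements `R_{i,j}` of numbered edges and of the field operators of the
legs. -/
def edgeProd (G : Matrix X X ℂ) {q n : ℕ} (E : Fin q → Fin k × Fin k) (e : Fin n → Fin k)
    (x : Fin n → X) : TPow X k :=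
  (∏ j, Rij G (E j).1 (E j).2) * ∏ l, single (e l) (phi (x l))

/-- Expanding the product over edges and legs yields exactly the graphs whose image under merging
`i` and `i + 1` is the given one. -/
theorem split_edgeProd (G : Matrix X X ℂ) {q n : ℕ} (i : Fin k) (E : Fin q → Fin k × Fin k)
    (e : Fin n → Fin k) (x : Fin n → X) :
    split X i (edgeProd G E e x) = ∑ E' : Fin q → Fin (k + 1) × Fin (k + 1),
      ∑ e' : Fin n → Fin (k + 1),
        if (fun j => Prod.map i.predAbove i.predAbove (E' j)) = E ∧ i.predAbove ∘ e' = e then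
          edgeProd G E' e' x else 0 := by
  simp only [edgeProd, map_mul, map_prod, split_Rij, split_single_phi]
  rw [Finset.prod_univ_sum, Finset.prod_univ_sum, Finset.sum_mul_sum]
  simp only [Fintype.piFinset_univ]
  refine Finset.sum_congr rfl fun E' _ => Finset.sum_congr rfl fun e' _ => ?_
  rw [Finset.prod_ite_zero, Finset.prod_ite_zero, ite_zero_mul_ite_zero]
  simp only [Finset.mem_univ, true_imp_iff, funext_iff, Function.comp_apply, Prod.mk.eta]

end Split

/-! ### The weights of the ordered trees in `Λ^k` -/

section Weight

/-- The coefficient in `Λ^k` of the graph with vertices `0, …, k`, numbered and oriented internal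
edges `E`, the first edge being the one created last, and legs attached by `e`. -/
def treeWeight {n : ℕ} : (k : ℕ) → (Fin k → Fin (k + 1) × Fin (k + 1)) →
    (Fin n → Fin (k + 1)) → ℚ
  | 0, _, _ => 1
  | k + 1, E, e => 1 / (2 * (k + 1 : ℕ)) * ∑ i : Fin (k + 1),
      if E 0 = (i.castSucc, i.succ) then
        treeWeight k (fun j => Prod.map i.predAbove i.predAbove (E j.succ)) (i.predAbove ∘ e)
      else 0

variable {X : Type u} [Fintype X] [DecidableEq X] {n : ℕ}

theorem edgeProd_cons (G : Matrix X X ℂ) {k q : ℕ} (p : Fin k × Fin k)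
    (E : Fin q → Fin k × Fin k) (e : Fin n → Fin k) (x : Fin n → X) :
    edgeProd G (Fin.cons p E : Fin (q + 1) → Fin k × Fin k) e x =
      Rij G p.1 p.2 * edgeProd G E e x := by
  simp [edgeProd, Fin.prod_univ_succ, mul_assoc]

theorem Lambda_prod_phi (G : Matrix X X ℂ) (k : ℕ) (x : Fin n → X) :
    Lambda G k (∏ l, phi (x l)) = ∑ E : Fin k → Fin (k + 1) × Fin (k + 1),
      ∑ e : Fin n → Fin (k + 1), (treeWeight k E e : ℂ) • edgeProd G E e x := by
  induction k with
  | zero =>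
    have : Unique (Fin n → Fin (0 + 1)) := inferInstanceAs (Unique (Fin n → Fin 1))
    rw [Fintype.sum_unique, Fintype.sum_unique]
    simp only [Lambda, treeWeight, edgeProd, AlgHom.toLinearMap_apply, map_prod, Rat.cast_one,
      one_smul, Finset.univ_eq_empty, Finset.prod_empty, one_mul]
    exact Finset.prod_congr rfl fun l _ =>
      congrArg (fun m : Fin (0 + 1) => single m (phi (x l))) (Subsingleton.elim (α := Fin 1) _ _)
  | succ k ih =>
    have hQ (i : Fin (k + 1)) : Qi G i (Lambda G k (∏ l, phi (x l))) =
        ∑ E' : Fin k → Fin (k + 2) × Fin (k + 2), ∑ e' : Fin n → Fin (k + 2),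
          ((1 / 2 : ℂ) * treeWeight k (fun j => Prod.map i.predAbove i.predAbove (E' j))
            (i.predAbove ∘ e')) •
            (Rij G i.castSucc i.succ * edgeProd G E' e' x) := by
      simp only [Qi_eq, ih, map_sum, map_smul, split_edgeProd, mul_smul, Finset.smul_sum,
        Finset.mul_sum]
      have h (E : Fin k → Fin (k + 1) × Fin (k + 1)) (e : Fin n → Fin (k + 1))
          (E' : Fin k → Fin (k + 2) × Fin (k + 2)) (e' : Fin n → Fin (k + 2)) :
          (treeWeight k E e : ℂ) • (1 / 2 : ℂ) • (Rij G i.castSucc i.succ *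
            if (fun j => Prod.map i.predAbove i.predAbove (E' j)) = E ∧ i.predAbove ∘ e' = e then
              edgeProd G E' e' x else 0) =
          if (fun j => Prod.map i.predAbove i.predAbove (E' j)) = E then
            if i.predAbove ∘ e' = e then (1 / 2 : ℂ) • (treeWeight k E e : ℂ) •
              (Rij G i.castSucc i.succ * edgeProd G E' e' x) else 0 else 0 := by
        rw [smul_comm]
        split_ifs <;> simp_all
      simp only [h]
      rw [Finset.sum_congr rfl fun E _ => Finset.sum_comm]
      rw [Finset.sum_comm]
      refine Finset.sum_congr rfl fun E' _ => ?_
      rw [Finset.sum_congr rfl fun E _ => Finset.sum_comm, Finset.sum_comm]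
      refine Finset.sum_congr rfl fun e' _ => ?_
      simp
    rw [Lambda, LinearMap.smul_apply, LinearMap.sum_apply]
    simp only [LinearMap.comp_apply, hQ]
    -- The edge contributed by `R_{i,i+1}` becomes edge `0`, and the older ones are renumbered by
    -- `succ`.
    rw [← (Fin.consEquiv fun _ => Fin (k + 2) × Fin (k + 2)).sum_comp, Fintype.sum_prod_type]
    simp only [Fin.consEquiv_apply, treeWeight, Fin.cons_zero, Fin.cons_succ]
    have h (p : Fin (k + 2) × Fin (k + 2)) (E' : Fin k → Fin (k + 2) × Fin (k + 2))
        (e' : Fin n → Fin (k + 2)) :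
        ((1 / (2 * (k + 1 : ℕ)) * ∑ i : Fin (k + 1), if p = (i.castSucc, i.succ) then
          treeWeight k (fun j => Prod.map i.predAbove i.predAbove (E' j)) (i.predAbove ∘ e')
          else 0 : ℚ) : ℂ) •
          edgeProd G ((Fin.consEquiv fun _ => Fin (k + 2) × Fin (k + 2)) (p, E')) e' x =
        ∑ i : Fin (k + 1), if p = (i.castSucc, i.succ) then
          (1 / (k + 1 : ℕ) : ℂ) • ((1 / 2 : ℂ) * treeWeight k
            (fun j => Prod.map i.predAbove i.predAbove (E' j)) (i.predAbove ∘ e')) •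
            (Rij G i.castSucc i.succ * edgeProd G E' e' x) else 0 := by
      rw [show (Fin.consEquiv fun _ => Fin (k + 2) × Fin (k + 2)) (p, E') = Fin.cons p E' from rfl,
        edgeProd_cons, Rat.cast_mul, Rat.cast_sum, Finset.mul_sum, Finset.sum_smul]
      refine Finset.sum_congr rfl fun i _ => ?_
      split_ifs with hp
      · subst hp
        rw [smul_smul]
        congr 1
        have : (k + 1 : ℂ) ≠ 0 := Nat.cast_add_one_ne_zero k
        push_cast
        field_simp
      · simp
    simp only [h]
    rw [Finset.smul_sum]
    symm
    rw [Finset.sum_congr rfl fun p _ => (Finset.sum_congr rfl fun E' _ => Finset.sum_comm).trans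
      Finset.sum_comm, Finset.sum_comm]
    refine Finset.sum_congr rfl fun i _ => ?_
    rw [Finset.sum_comm, Finset.smul_sum]
    refine Finset.sum_congr rfl fun E' _ => ?_
    rw [Finset.sum_comm, Finset.smul_sum]
    refine Finset.sum_congr rfl fun e' _ => ?_
    simp

end Weight

/-! ### Connected graphs given by numbered edges -/

section EdgesGraph

variable {V : Type*} {q k n : ℕ}

/-- The simple graph whose edges are the members of a family of pairs. -/
def edgesGraph (E : Fin q → V × V) : SimpleGraph V :=
  SimpleGraph.fromRel fun a b => ∃ j ∈ Set.univ, (E j).1 = a ∧ (E j).2 = b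

theorem edgesGraph_adj (E : Fin q → V × V) (a b : V) :
    (edgesGraph E).Adj a b ↔ a ≠ b ∧ ∃ j, s((E j).1, (E j).2) = s(a, b) := by
  simp [edgesGraph, ← exists_or, Prod.ext_iff]

theorem edgesGraph_connected_iff (E : Fin q → V × V) :
    (edgesGraph E).Connected ↔
      Joined (fun j => (E j).1) (fun j => (E j).2) Set.univ :=
  connected_fromRel_iff (fun j => (E j).1) (fun j => (E j).2) Set.univ

theorem edgeSet_edgesGraph_subset (E : Fin q → V × V) :
    (edgesGraph E).edgeSet ⊆ Set.range fun j => s((E j).1, (E j).2) := by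
  rintro ⟨a, b⟩ h
  exact ((edgesGraph_adj E a b).1 h).2

/-- Connectedness of `k + 1` vertices needs `k` edges and the family supplies at most that many.
Equality also forces it to have neither repetitions nor loops. -/
theorem ncard_edgeSet_edgesGraph {E : Fin k → Fin (k + 1) × Fin (k + 1)}
    (h : (edgesGraph E).Connected) : (edgesGraph E).edgeSet.ncard = k := by
  have h1 := h.card_vert_le_card_edgeSet_add_one
  rw [Nat.card_fin, Nat.card_coe_set_eq] at h1
  have h2 := Set.ncard_le_ncard (edgeSet_edgesGraph_subset E) (Set.finite_range _)
  have h3 := Set.ncard_image_le (f := fun j => s((E j).1, (E j).2)) (Set.finite_univ (α := Fin k))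
  rw [Set.image_univ, Set.ncard_univ, Nat.card_fin] at h3
  omega

theorem isTree_edgesGraph {E : Fin k → Fin (k + 1) × Fin (k + 1)}
    (h : (edgesGraph E).Connected) : (edgesGraph E).IsTree := by
  rw [SimpleGraph.isTree_iff_connected_and_card, Nat.card_fin, Nat.card_coe_set_eq,
    ncard_edgeSet_edgesGraph h]
  exact ⟨h, rfl⟩

theorem edgeSet_edgesGraph {E : Fin k → Fin (k + 1) × Fin (k + 1)}
    (h : (edgesGraph E).Connected) :
    (edgesGraph E).edgeSet = Set.range fun j => s((E j).1, (E j).2) := by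
  refine Set.eq_of_subset_of_ncard_le (edgeSet_edgesGraph_subset E) ?_ (Set.finite_range _)
  have h3 := Set.ncard_image_le (f := fun j => s((E j).1, (E j).2)) (Set.finite_univ (α := Fin k))
  rw [Set.image_univ, Set.ncard_univ, Nat.card_fin] at h3
  rwa [ncard_edgeSet_edgesGraph h]

theorem injective_edges {E : Fin k → Fin (k + 1) × Fin (k + 1)}
    (h : (edgesGraph E).Connected) : Function.Injective fun j => s((E j).1, (E j).2) := by
  have h1 := ncard_edgeSet_edgesGraph h
  rw [edgeSet_edgesGraph h, ← Set.image_univ] at h1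
  rw [← Set.injOn_univ]
  exact Set.injOn_of_ncard_image_eq (by rw [h1, Set.ncard_univ, Nat.card_fin])

theorem edge_ne {E : Fin k → Fin (k + 1) × Fin (k + 1)}
    (h : (edgesGraph E).Connected) (j : Fin k) : (E j).1 ≠ (E j).2 := by
  have h1 : s((E j).1, (E j).2) ∈ (edgesGraph E).edgeSet := by
    rw [edgeSet_edgesGraph h]
    exact ⟨j, rfl⟩
  exact (edgesGraph E).ne_of_adj h1

theorem edgesGraph_map (E : Fin q → V × V) (π : Equiv.Perm V) :
    edgesGraph (fun j => Prod.map π π (E j)) = (edgesGraph E).map π := by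
  ext a b
  obtain ⟨a, rfl⟩ := π.surjective a
  obtain ⟨b, rfl⟩ := π.surjective b
  have h := SimpleGraph.map_adj_apply (G := edgesGraph E) (f := π.toEmbedding) (a := a) (b := b)
  simp only [Equiv.coe_toEmbedding] at h
  rw [h, edgesGraph_adj, edgesGraph_adj, π.injective.ne_iff]
  simp [Prod.map, π.injective.eq_iff, Prod.ext_iff]

/-- A connected graph stays connected when an edge is contracted. -/
theorem connected_contract {E : Fin (k + 1) → Fin (k + 2) × Fin (k + 2)} {i : Fin (k + 1)}
    (hE : E 0 = (i.castSucc, i.succ)) :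
    (edgesGraph fun j : Fin k => Prod.map i.predAbove i.predAbove (E j.succ)).Connected ↔
      (edgesGraph E).Connected := by
  rw [edgesGraph_connected_iff, edgesGraph_connected_iff]
  constructor
  · rintro ⟨-, h⟩
    refine ⟨inferInstance, fun f hf a b ha => ?_⟩
    have h0 : f (E 0).1 ↔ f (E 0).2 := hf 0 (Set.mem_univ _)
    rw [hE] at h0
    -- The composite sends `i.castSucc` to `i.succ` and fixes all else; as `f` agrees at these two
    -- vertices, it descends to the contracted graph.
    have key (a : Fin (k + 2)) : f (i.castSucc.succAbove (i.predAbove a)) ↔ f a := by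
      rcases eq_or_ne a i.castSucc with rfl | ha
      · rw [Fin.predAbove_castSucc_self, Fin.succAbove_castSucc_self, h0]
      · obtain ⟨m, rfl⟩ := Fin.exists_succAbove_eq ha
        rw [Fin.predAbove_succAbove]
    rw [← key] at ha ⊢
    refine h (fun m => f (i.castSucc.succAbove m)) (fun j _ => ?_) _ _ ha
    simpa only [Prod.map, key] using hf j.succ (Set.mem_univ _)
  · rintro ⟨-, h⟩
    refine ⟨inferInstance, fun f hf a b ha => ?_⟩
    have h1 := h (fun m => f (i.predAbove m)) (fun j _ => ?_) (i.castSucc.succAbove a)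
      (i.castSucc.succAbove b)
    · simpa only [Fin.predAbove_succAbove, ha, true_imp_iff] using h1
    · induction j using Fin.cases with
      | zero => simp [hE]
      | succ j => exact hf j (Set.mem_univ _)

/-- Only connected graphs with increasing edges have a weight. -/
theorem of_treeWeight_ne_zero {E : Fin k → Fin (k + 1) × Fin (k + 1)} {e : Fin n → Fin (k + 1)}
    (h : treeWeight k E e ≠ 0) : (∀ j, (E j).1 < (E j).2) ∧ (edgesGraph E).Connected := by
  induction k with
  | zero =>
    refine ⟨fun j => j.elim0, (edgesGraph_connected_iff E).2 ⟨inferInstance, fun f _ a b ha => ?_⟩⟩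
    rwa [Subsingleton.elim (α := Fin 1) b a]
  | succ k ih =>
    rw [treeWeight] at h
    obtain ⟨i, -, hi⟩ := Finset.exists_ne_zero_of_sum_ne_zero (right_ne_zero_of_mul h)
    rw [ne_eq, ite_eq_right_iff, not_forall] at hi
    obtain ⟨h0, hi⟩ := hi
    obtain ⟨h1, h2⟩ := ih hi
    refine ⟨fun j => ?_, (connected_contract h0).1 h2⟩
    induction j using Fin.cases with
    | zero => simp [h0]
    | succ j => exact lt_of_not_ge fun hle => (h1 j).not_ge (Fin.predAbove_right_monotone i hle)

end EdgesGraph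

/-! ### The sum of the weights over all orderings of the vertices -/

section Orderings

variable {k n : ℕ}

/-- The permutation of `k + 2` points that arises from a permutation `ρ` of `k + 1` points by
doubling the point `0`. -/
def doublePerm (ρ : Equiv.Perm (Fin (k + 1))) : Equiv.Perm (Fin (k + 2)) :=
  ((finSuccEquiv' 0).trans ρ.optionCongr).trans (finSuccEquiv' (ρ 0).castSucc).symm

theorem doublePerm_zero (ρ : Equiv.Perm (Fin (k + 1))) : doublePerm ρ 0 = (ρ 0).castSucc := by
  simp [doublePerm]

theorem doublePerm_succ (ρ : Equiv.Perm (Fin (k + 1))) (j : Fin (k + 1)) :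
    doublePerm ρ j.succ = (ρ 0).castSucc.succAbove (ρ j) := by
  have h : finSuccEquiv' (0 : Fin (k + 2)) j.succ = some j := by
    rw [← Fin.succAbove_zero, finSuccEquiv'_succAbove]
  simp [doublePerm, h]

theorem doublePerm_one (ρ : Equiv.Perm (Fin (k + 1))) : doublePerm ρ 1 = (ρ 0).succ := by
  rw [← Fin.succ_zero_eq_one, doublePerm_succ, Fin.succAbove_castSucc_self]

theorem predAbove_doublePerm (ρ : Equiv.Perm (Fin (k + 1))) (a : Fin (k + 2)) :
    (ρ 0).predAbove (doublePerm ρ a) = ρ (Fin.predAbove 0 a) := by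
  induction a using Fin.cases with
  | zero => rw [doublePerm_zero, Fin.predAbove_castSucc_self]; simp
  | succ j => rw [doublePerm_succ, Fin.predAbove_succAbove, Fin.predAbove_zero_succ]

theorem exists_doublePerm (π : Equiv.Perm (Fin (k + 2))) (i : Fin (k + 1))
    (h0 : π 0 = i.castSucc) (h1 : π 1 = i.succ) :
    ∃ ρ : Equiv.Perm (Fin (k + 1)), doublePerm ρ = π ∧ ρ 0 = i := by
  have key (j : Fin (k + 1)) : i.castSucc.succAbove (i.predAbove (π j.succ)) = π j.succ := by
    have hne : π j.succ ≠ i.castSucc := by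
      rw [← h0, π.injective.ne_iff]
      exact Fin.succ_ne_zero j
    obtain ⟨m, hm⟩ := Fin.exists_succAbove_eq hne
    rw [← hm, Fin.predAbove_succAbove]
  have hinj : Function.Injective fun j : Fin (k + 1) => i.predAbove (π j.succ) := by
    intro a b hab
    have := congrArg i.castSucc.succAbove hab
    simpa only [key, π.injective.eq_iff, Fin.succ_inj] using this
  let ρ := Equiv.ofBijective _ (Finite.injective_iff_bijective.1 hinj)
  have hρ (j : Fin (k + 1)) : ρ j = i.predAbove (π j.succ) := rfl
  have hρ0 : ρ 0 = i := by rw [hρ, Fin.succ_zero_eq_one, h1, Fin.predAbove_succ_self]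
  refine ⟨ρ, ?_, hρ0⟩
  ext1 a
  induction a using Fin.cases with
  | zero => rw [doublePerm_zero, hρ0, h0]
  | succ j => rw [doublePerm_succ, hρ0, hρ, key]

/-- Only orderings that put `0` and `1` at positions `i` and `i + 1` contribute. They are the
`doublePerm ρ` with `ρ 0 = i`, for the orderings `ρ` of the contracted graph. -/
theorem sum_treeWeight_of_zero_one (E : Fin (k + 1) → Fin (k + 2) × Fin (k + 2))
    (e : Fin n → Fin (k + 2)) (hE : E 0 = (0, 1)) :
    ∑ π : Equiv.Perm (Fin (k + 2)), treeWeight (k + 1) (fun j => Prod.map π π (E j)) (π ∘ e) =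
      1 / (2 * (k + 1 : ℕ)) * ∑ ρ : Equiv.Perm (Fin (k + 1)),
        treeWeight k (fun j => Prod.map ρ ρ (Prod.map (Fin.predAbove 0) (Fin.predAbove 0)
          (E j.succ))) (ρ ∘ Fin.predAbove 0 ∘ e) := by
  simp only [treeWeight]
  rw [← Finset.mul_sum]
  congr 1
  rw [← Fintype.sum_prod_type', ← Finset.sum_filter]
  symm
  refine Finset.sum_bij (fun ρ _ => (doublePerm ρ, ρ 0)) ?_ ?_ ?_ ?_
  · intro ρ _
    simp [hE, doublePerm_zero, doublePerm_one]
  · intro ρ _ ρ' _ h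
    rw [Prod.mk.injEq] at h
    ext1 j
    have h1 := congrArg (fun π : Equiv.Perm (Fin (k + 2)) => π j.succ) h.1
    simpa only [doublePerm_succ, h.2, Fin.succAbove_right_inj] using h1
  · rintro ⟨π, i⟩ h
    simp only [Finset.mem_filter, hE, Prod.map, Prod.mk.injEq] at h
    obtain ⟨ρ, h1, h2⟩ := exists_doublePerm π i h.2.1 h.2.2
    exact ⟨ρ, Finset.mem_univ _, by rw [h1, h2]⟩
  · intro ρ _
    congr 1
    · funext j
      simp [Prod.map, predAbove_doublePerm]
    · funext l
      simp [predAbove_doublePerm]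

theorem exists_perm_zero_one {a b : Fin (k + 2)} (h : a ≠ b) :
    ∃ π : Equiv.Perm (Fin (k + 2)), π a = 0 ∧ π b = 1 := by
  refine ⟨Equiv.swap (Equiv.swap a 0 b) 1 * Equiv.swap a 0, ?_, ?_⟩
  · rw [Equiv.Perm.mul_apply, Equiv.swap_apply_left, Equiv.swap_apply_of_ne_of_ne]
    · intro h0
      apply h
      rw [← (Equiv.swap a 0).injective.eq_iff, Equiv.swap_apply_left]
      exact h0
    · simp
  · simp

/-- The weights of all orderings of the vertices of a connected graph with `k + 1` vertices and
`k` numbered and oriented edges. -/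
theorem sum_treeWeight_perm (E : Fin k → Fin (k + 1) × Fin (k + 1)) (e : Fin n → Fin (k + 1))
    (hE : (edgesGraph E).Connected) :
    ∑ π : Equiv.Perm (Fin (k + 1)), treeWeight k (fun j => Prod.map π π (E j)) (π ∘ e) =
      1 / (k.factorial * 2 ^ k) := by
  induction k with
  | zero =>
    simp only [treeWeight]
    simp
  | succ k ih =>
    -- The sum runs over all orderings, so the newest edge may be assumed to go from `0` to `1`.
    obtain ⟨π₀, ha, hb⟩ := exists_perm_zero_one (edge_ne hE 0)
    rw [← Equiv.sum_comp (Equiv.mulRight π₀)]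
    have h0 : (fun j => Prod.map π₀ π₀ (E j)) 0 = (0, 1) := by
      simp only [Prod.map, ha, hb]
    have hconn : (edgesGraph fun j => Prod.map π₀ π₀ (E j)).Connected := by
      rw [edgesGraph_map]
      exact (SimpleGraph.Iso.map π₀ (edgesGraph E)).connected_iff.1 hE
    have h1 := sum_treeWeight_of_zero_one (fun j => Prod.map π₀ π₀ (E j)) (π₀ ∘ e) h0
    rw [ih _ _ ((connected_contract (i := 0) h0).2 hconn)] at h1
    refine Eq.trans (Finset.sum_congr rfl fun π _ => ?_) (h1.trans ?_)
    · rfl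
    · rw [Nat.factorial_succ]
      push_cast
      have : (k + 1 : ℚ) ≠ 0 := Nat.cast_add_one_ne_zero k
      field_simp
      ring

end Orderings

/-! ### Numberings and orientations of the edges of a tree -/

section Count

variable {V : Type*} [Fintype V] [DecidableEq V] {k : ℕ}

theorem card_orientations {z : Sym2 V} (hz : ¬ z.IsDiag) :
    (Finset.univ.filter fun p : V × V => s(p.1, p.2) = z).card = 2 := by
  induction z with
  | h a b =>
    rw [Sym2.mk_isDiag_iff] at hz
    rw [← Finset.card_pair (a := (a, b)) (b := (b, a)) (by simp [hz])]
    congr 1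
    ext p
    simp [Prod.ext_iff]

-- A family that represents `t` consists of a numbering `b` of the edges of `t`, uniquely
-- determined, and one of two orientations for each edge.
open Classical in
theorem card_edgesGraph_eq {t : SimpleGraph (Fin (k + 1))} (ht : t.IsTree) :
    (∑ E : Fin k → Fin (k + 1) × Fin (k + 1), if edgesGraph E = t then (1 : ℚ) else 0) =
      k.factorial * 2 ^ k := by
  have hcard : Fintype.card t.edgeSet = k := by
    have h := (SimpleGraph.isTree_iff_connected_and_card.1 ht).2
    rw [Nat.card_eq_fintype_card, Nat.card_fin] at h
    omega
  have hE (E : Fin k → Fin (k + 1) × Fin (k + 1)) :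
      (if edgesGraph E = t then (1 : ℚ) else 0) =
        ∑ b : Fin k ↪ t.edgeSet, ∏ j, if s((E j).1, (E j).2) = b j then (1 : ℚ) else 0 := by
    simp only [Finset.prod_ite_zero, Finset.prod_const_one, Finset.mem_univ, true_imp_iff]
    split_ifs with h
    · subst h
      have hc := ht.connected
      let b : Fin k ↪ (edgesGraph E).edgeSet :=
        ⟨fun j => ⟨s((E j).1, (E j).2), by rw [edgeSet_edgesGraph hc]; exact ⟨j, rfl⟩⟩,
          fun i j hij => injective_edges hc (congrArg Subtype.val hij)⟩
      rw [Finset.sum_eq_single b]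
      · exact (if_pos fun j => rfl).symm
      · intro b' _ hb
        refine if_neg fun hall => hb ?_
        ext j : 2
        exact (hall j).symm
      · simp
    · symm
      refine Finset.sum_eq_zero fun b _ => if_neg fun hall => h ?_
      have hb : Function.Surjective b :=
        ((Fintype.bijective_iff_injective_and_card b).2
          ⟨b.injective, by rw [Fintype.card_fin, hcard]⟩).2
      ext x y
      rw [edgesGraph_adj]
      constructor
      · rintro ⟨-, j, hj⟩
        have := (b j).2
        rwa [← hall j, hj] at this
      · intro hxy
        obtain ⟨j, hj⟩ := hb ⟨s(x, y), hxy⟩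
        exact ⟨hxy.ne, j, by rw [hall j, hj]⟩
  simp only [hE]
  rw [Finset.sum_comm]
  have hb (b : Fin k ↪ t.edgeSet) : ∑ E : Fin k → Fin (k + 1) × Fin (k + 1),
      ∏ j, (if s((E j).1, (E j).2) = b j then (1 : ℚ) else 0) = 2 ^ k := by
    have h := Finset.prod_univ_sum (fun _ : Fin k => Finset.univ)
      fun j (p : Fin (k + 1) × Fin (k + 1)) => if s(p.1, p.2) = b j then (1 : ℚ) else 0
    rw [Fintype.piFinset_univ] at h
    rw [← h]
    have h2 (j : Fin k) : ∑ p : Fin (k + 1) × Fin (k + 1),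
        (if s(p.1, p.2) = b j then (1 : ℚ) else 0) = 2 := by
      rw [Finset.sum_boole, card_orientations (t.not_isDiag_of_mem_edgeSet (b j).2)]
      rfl
    simp [h2]
  simp only [hb]
  rw [Finset.sum_const, Finset.card_univ, Fintype.card_embedding_eq, hcard, Fintype.card_fin,
    Nat.descFactorial_self, nsmul_eq_mul]

end Count

/-! ### Trees with labeled legs have no automorphisms -/

section Stabilizer

variable {V : Type*}

/-- Geodesics from `r` to `w` and `w'` extend to geodesics to `v`; paths in a tree are unique, so
their penultimate vertices agree. -/
theorem closer_neighbor_unique {t : SimpleGraph V} (ht : t.IsTree) {r v w w' : V}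
    (hw : t.Adj w v) (hw' : t.Adj w' v) (hd : t.dist r v = t.dist r w + 1)
    (hd' : t.dist r v = t.dist r w' + 1) : w = w' := by
  obtain ⟨p, -, hp⟩ := ht.connected.exists_path_of_dist r w
  obtain ⟨p', -, hp'⟩ := ht.connected.exists_path_of_dist r w'
  have h := (p.concat hw).isPath_of_length_eq_dist (by rw [SimpleGraph.Walk.length_concat, hp, hd])
  have h' := (p'.concat hw').isPath_of_length_eq_dist
    (by rw [SimpleGraph.Walk.length_concat, hp', hd'])
  have := congrArg (fun q : t.Path r v => q.1.penultimate)
    ((ht.isAcyclic.subsingleton_path r v).elim ⟨_, h⟩ ⟨_, h'⟩)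
  simpa using this

theorem dist_map_le {t : SimpleGraph V} (ht : t.Connected) (π : t →g t) (a b : V) :
    t.dist (π a) (π b) ≤ t.dist a b := by
  obtain ⟨p, hp⟩ := ht.exists_walk_length_eq_dist a b
  rw [← hp, ← SimpleGraph.Walk.length_map π p]
  exact SimpleGraph.dist_le _

theorem dist_iso {t : SimpleGraph V} (ht : t.Connected) (π : t ≃g t) (a b : V) :
    t.dist (π a) (π b) = t.dist a b := by
  refine (dist_map_le ht π.toHom a b).antisymm ?_
  simpa using dist_map_le ht π.symm.toHom (π a) (π b)

/-- A vertex of degree below two carries a leg and is fixed. With a leaf as root, distances to the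
root are preserved, and a moved vertex farthest from the root leads to a contradiction. -/
theorem eq_one_of_fixes_legs {k n : ℕ} {t : SimpleGraph (Fin k)} {e : Fin n → Fin k}
    (ht : t.IsTree) (hval : ∀ i, 2 ≤ valence t e i) (π : t ≃g t) (hπ : ∀ l, π (e l) = e l)
    (v : Fin k) : π v = v := by
  classical
  by_contra hv
  have : Nontrivial (Fin k) := ⟨⟨_, _, hv⟩⟩
  have fixed (i : Fin k) (hi : t.degree i < 2) : π i = i := by
    have h := hval i
    unfold valence at h
    have h1 : 0 < (Finset.univ.filter fun l => e l = i).card := by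
      convert_to t.degree i + _ ≥ 2 at h
      omega
    obtain ⟨l, hl⟩ := Finset.card_pos.1 h1
    rw [← (Finset.mem_filter.1 hl).2, hπ]
  obtain ⟨r, hr⟩ := ht.exists_vert_degree_one_of_nontrivial
  have hπr : π r = r := fixed r (by omega)
  have hdist (i : Fin k) : t.dist r (π i) = t.dist r i := by
    conv_lhs => rw [← hπr]
    exact dist_iso ht.connected π r i
  obtain ⟨u, hu, hmax⟩ := Finset.exists_max_image (Finset.univ.filter fun i => π i ≠ i)
    (fun i => t.dist r i) ⟨v, by simpa using hv⟩
  replace hu : π u ≠ u := by simpa using hu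
  have hdeg : 1 < t.degree u := by
    by_contra h
    exact hu (fixed u (by omega))
  rw [← SimpleGraph.card_neighborFinset_eq_degree, Finset.one_lt_card] at hdeg
  obtain ⟨w, hw, w', hw', hne⟩ := hdeg
  rw [SimpleGraph.mem_neighborFinset] at hw hw'
  -- At most one of two neighbors of `u` is closer to the root. The farther one is fixed by
  -- maximality, and both `u` and `π u` are its closer neighbor.
  have far : ∃ w, t.Adj u w ∧ t.dist r w = t.dist r u + 1 := by
    rcases ht.dist_eq_dist_add_one_of_adj r hw with h | h
    · rcases ht.dist_eq_dist_add_one_of_adj r hw' with h' | h'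
      · exact absurd (closer_neighbor_unique ht hw.symm hw'.symm h h') hne
      · exact ⟨w', hw', h'⟩
    · exact ⟨w, hw, h⟩
  obtain ⟨w, hw, h⟩ := far
  have hπw : π w = w := by
    by_contra hc
    have := hmax w (by simpa using hc)
    omega
  refine hu (closer_neighbor_unique ht (v := w) (r := r) ?_ hw (by rw [h, hdist]) h)
  have := π.map_adj_iff.2 hw
  rwa [hπw] at this

end Stabilizer

/-! ### The weights of the simple graphs -/

section GraphWeight

variable {k n : ℕ}

open Classical in
/-- The weight in `Λ^k` of a simple graph with ordered vertices. -/
def graphWeight (t : SimpleGraph (Fin (k + 1))) (e : Fin n → Fin (k + 1)) : ℚ :=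
  ∑ E : Fin k → Fin (k + 1) × Fin (k + 1), if edgesGraph E = t then treeWeight k E e else 0

theorem graphWeight_eq_zero {t : SimpleGraph (Fin (k + 1))} (ht : ¬ t.IsTree)
    (e : Fin n → Fin (k + 1)) : graphWeight t e = 0 := by
  classical
  refine Finset.sum_eq_zero fun E _ => ite_eq_right_iff.2 fun h => ?_
  by_contra hw
  exact ht (h ▸ isTree_edgesGraph (of_treeWeight_ne_zero hw).2)

/-- Connectedness excludes repeated edges, and increasing orientation matches the convention `i <
j`, so both products have the same factors. -/
theorem graphElement_edgesGraph {X : Type u} [Fintype X] [DecidableEq X] (G : Matrix X X ℂ)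
    {E : Fin k → Fin (k + 1) × Fin (k + 1)} (hlt : ∀ j, (E j).1 < (E j).2)
    (hc : (edgesGraph E).Connected) (e : Fin n → Fin (k + 1)) (x : Fin n → X) :
    graphElement G (edgesGraph E) e x = edgeProd G E e x := by
  classical
  rw [graphElement, edgeProd]
  congr 1
  have hinj : Function.Injective E := fun i j h => injective_edges hc (by simp [h])
  rw [← Finset.prod_image (s := Finset.univ) (g := E) (f := fun p => Rij G p.1 p.2) hinj.injOn]
  refine Finset.prod_congr ?_ fun _ _ => rfl
  ext p
  simp only [Finset.mem_filter, Finset.mem_univ, true_and, Finset.mem_image, edgesGraph_adj]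
  constructor
  · rintro ⟨hp, -, j, hj⟩
    refine ⟨j, ?_⟩
    rcases Sym2.mk_eq_mk_iff.1 hj with h | h
    · exact h
    · have := hlt j
      rw [h] at this
      exact absurd this hp.not_gt
  · rintro ⟨j, rfl⟩
    exact ⟨hlt j, (hlt j).ne, j, rfl⟩

open Classical in
theorem Lambda_eq_sum_graphElement {X : Type u} [Fintype X] [DecidableEq X] (G : Matrix X X ℂ)
    (x : Fin n → X) : Lambda G k (∏ l, phi (x l)) =
      ∑ t, ∑ e, (graphWeight t e : ℂ) • graphElement G t e x := by
  rw [Lambda_prod_phi, Finset.sum_comm]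
  symm
  rw [Finset.sum_comm]
  refine Finset.sum_congr rfl fun e _ => ?_
  have h (t : SimpleGraph (Fin (k + 1))) : (graphWeight t e : ℂ) • graphElement G t e x =
      ∑ E, if edgesGraph E = t then (treeWeight k E e : ℂ) • edgeProd G E e x else 0 := by
    rw [graphWeight, Rat.cast_sum, Finset.sum_smul]
    refine Finset.sum_congr rfl fun E _ => ?_
    split_ifs with hE
    · by_cases h0 : treeWeight k E e = 0
      · simp [h0]
      · obtain ⟨h1, h2⟩ := of_treeWeight_ne_zero h0
        rw [← hE, graphElement_edgesGraph G h1 h2]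
    · simp
  simp only [h]
  rw [Finset.sum_comm]
  simp

/-- Each of the `k! 2^k` edge families representing `t` contributes `1/(k! 2^k)`. -/
theorem sum_graphWeight_perm {t : SimpleGraph (Fin (k + 1))} (ht : t.IsTree)
    (e : Fin n → Fin (k + 1)) :
    ∑ π : Equiv.Perm (Fin (k + 1)), graphWeight (t.map π) (π ∘ e) = 1 := by
  classical
  have h (π : Equiv.Perm (Fin (k + 1))) : graphWeight (t.map π) (π ∘ e) =
      ∑ E : Fin k → Fin (k + 1) × Fin (k + 1), if edgesGraph E = t then
        treeWeight k (fun j => Prod.map π π (E j)) (π ∘ e) else 0 := by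
    rw [graphWeight, ← Equiv.sum_comp (Equiv.arrowCongr (Equiv.refl (Fin k)) (π.prodCongr π))]
    refine Finset.sum_congr rfl fun E _ => ?_
    refine if_congr ?_ rfl rfl
    exact (Eq.congr_left (edgesGraph_map E π)).trans
      (SimpleGraph.map_injective π.toEmbedding).eq_iff
  simp only [h]
  rw [Finset.sum_comm]
  have h2 (E : Fin k → Fin (k + 1) × Fin (k + 1)) :
      (∑ π : Equiv.Perm (Fin (k + 1)), if edgesGraph E = t then
        treeWeight k (fun j => Prod.map π π (E j)) (π ∘ e) else 0) =
      (if edgesGraph E = t then (1 : ℚ) else 0) * (1 / (k.factorial * 2 ^ k)) := by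
    split_ifs with hE
    · rw [sum_treeWeight_perm E e (hE ▸ ht.connected), one_mul]
    · simp
  simp only [h2]
  rw [← Finset.sum_mul, card_edgesGraph_eq ht]
  have : (k.factorial : ℚ) ≠ 0 := Nat.cast_ne_zero.2 k.factorial_ne_zero
  field_simp

theorem sameUnordered_iff (t t' : SimpleGraph (Fin k)) (e e' : Fin n → Fin k) :
    SameUnordered t t' e e' ↔ ∃ π : Equiv.Perm (Fin k), t.map π = t' ∧ π ∘ e = e' := by
  refine exists_congr fun π => and_congr ?_ ?_
  · constructor
    · intro h
      ext a b
      obtain ⟨a, rfl⟩ := π.surjective a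
      obtain ⟨b, rfl⟩ := π.surjective b
      rw [h]
      exact SimpleGraph.map_adj_apply (f := π.toEmbedding)
    · rintro rfl i j
      exact SimpleGraph.map_adj_apply (f := π.toEmbedding)
  · rw [funext_iff]
    exact forall_congr' fun l => eq_comm

-- Two permutations with the same effect on `(t, e)` differ by an automorphism of `t` that fixes the
-- legs, hence are equal. So summing over orderings is summing over permutations.
open Classical in
theorem sum_graphWeight_sameUnordered {t : SimpleGraph (Fin (k + 1))} {e : Fin n → Fin (k + 1)}
    (ht : t.IsTree) (hval : ∀ i, 2 ≤ valence t e i) :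
    ∑ t', ∑ e', (if SameUnordered t t' e e' then graphWeight t' e' else 0) = 1 := by
  rw [← Fintype.sum_prod_type', ← Finset.sum_filter, ← sum_graphWeight_perm ht e]
  symm
  refine Finset.sum_bij (fun π _ => (t.map π, π ∘ e)) ?_ ?_ ?_ fun _ _ => rfl
  · intro π _
    simp only [Finset.mem_filter, Finset.mem_univ, true_and, sameUnordered_iff]
    exact ⟨π, rfl, rfl⟩
  · intro π _ ρ _ h
    rw [Prod.mk.injEq] at h
    let φ : t ≃g t := ⟨π.trans ρ.symm, by
      intro a b
      have h1 := SimpleGraph.map_adj_apply (G := t) (f := π.toEmbedding) (a := a) (b := b)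
      have h2 := SimpleGraph.map_adj_apply (G := t) (f := ρ.toEmbedding)
        (a := ρ.symm (π a)) (b := ρ.symm (π b))
      simp only [Equiv.coe_toEmbedding, Equiv.apply_symm_apply] at h1 h2
      rw [h.1] at h1
      exact h2.symm.trans h1⟩
    ext1 a
    have := eq_one_of_fixes_legs ht hval φ (fun l => ρ.symm_apply_eq.2 (congrFun h.2 l)) a
    exact ρ.symm_apply_eq.1 this
  · rintro ⟨t', e'⟩ h
    simp only [Finset.mem_filter, Finset.mem_univ, true_and, sameUnordered_iff] at h
    obtain ⟨π, rfl, rfl⟩ := h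
    exact ⟨π, Finset.mem_univ _, rfl⟩

end GraphWeight

end NPoint

end

/-! ### Conclusion -/

open Classical in
open NPoint in
theorem mainTheorem1 :
    -- the connected functions in terms of the 1PI ones
    (∀ (X : Type*) [Fintype X] [DecidableEq X] (J : Type*) (G : Matrix X X ℂ)
        (ν : FieldAlg X →ₗ[ℂ] MvPowerSeries J ℂ),
      G.IsSymm → IsUnit G.det → IsInteraction ν →
      (∀ x : Fin 1 → X, onePIFn G ν 1 x = 0) →
      -- the sums over graphs are finite at each order
      (∀ (n : ℕ) (x : Fin n → X) (d : J →₀ ℕ),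
        {Γ : FeynmanGraph n | MvPowerSeries.coeff d (Γ.value G ν x) ≠ 0}.Finite) ∧
      -- the `n`-point functions do define linear maps on `S(V)`
      (∃ σ, IsNPointMap (connectedFn G ν) σ) ∧ (∃ τ, IsNPointMap (onePIFn G ν) τ) ∧
      ∀ σ τ : FieldAlg X →ₗ[ℂ] MvPowerSeries J ℂ,
        IsNPointMap (connectedFn G ν) σ → IsNPointMap (onePIFn G ν) τ →
        ∀ (a : FieldAlg X) (d : J →₀ ℕ),
          {k : ℕ | MvPowerSeries.coeff d (sigmaComponent G τ k a) ≠ 0}.Finite ∧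
          MvPowerSeries.coeff d (σ a) =
            ∑ᶠ k : ℕ, MvPowerSeries.coeff d (sigmaComponent G τ k a)) ∧
    -- `Λ^k` is a weighted sum of the trees with `k + 1` vertices, and each tree with all valences
    -- at least two has weight one as a graph with unordered vertices
    (∀ k n : ℕ, ∃ w : SimpleGraph (Fin (k + 1)) → (Fin n → Fin (k + 1)) → ℚ,
      (∀ t e, ¬ t.IsTree → w t e = 0) ∧
      (∀ (X : Type*) [Fintype X] [DecidableEq X] (G : Matrix X X ℂ),
        G.IsSymm → IsUnit G.det → ∀ x : Fin n → X,
          Lambda G k (∏ i, phi (x i)) = ∑ t, ∑ e, (w t e : ℂ) • graphElement G t e x) ∧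
      (∀ t e, t.IsTree → (∀ i, 2 ≤ valence t e i) →
        ∑ t', ∑ e', (if SameUnordered t t' e e' then w t' e' else 0) = 1)) := by
  refine ⟨?_, ?_⟩
  · intro X _ _ J G ν hG hG' hν h1
    exact ⟨fun n x d => hν.finite_graphs G x d,
      exists_isNPointMap fun _ _ e y => connectedFn_comp hν e y,
      exists_isNPointMap fun _ _ e y => onePIFn_comp hν e y,
      fun σ τ hσ hτ a d => connected_eq_sum_sigmaComponent hG hG' hν h1 hσ hτ a d⟩
  · intro k n
    refine ⟨graphWeight, fun t e ht => graphWeight_eq_zero ht e, ?_, ?_⟩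
    · intro X _ _ G _ _ x
      rw [Lambda_eq_sum_graphElement G x]
    · intro t e ht hval
      exact sum_graphWeight_sameUnordered ht hval
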